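/- A \emph{path} is the graph of a continuous function $f:[0,1]\to\mathbb{R}$. A \emph{system} is a finite collection of at least three paths such that: distinct paths have distinct left endpoints and distinct right endpoints; any two distinct paths meet in finitely many points; any two distinct paths cross at every point where they meet (there, one of them passes from below to above the other); and no three distinct paths have a common point. The \emph{size} of a system is its number of paths, and a \emph{subsystem} is a subset of at least three of its paths. A system is \emph{$k$-crossing} if each pair of distinct paths crosses at least once and at most $k$ times. A path \emph{appears on the upper envelope} of a system if there is some $t\in[0,1]$ at which it lies strictly above every other path of the system. The system is \emph{upper convex} if all its paths appear on the upper envelope. The \emph{signature} of a system of size $3$, with paths labelled $1,2,3$ from bottom to top according to their left endpoints, is the word over $\{x,y,z\}$ obtained by reading its crossings from left to right and writing $x$, $y$, $z$ for a crossing of the paths $\{1,2\}$, $\{1,3\}$, $\{2,3\}$, respectively. A system is \emph{regular} if it has size at least $4$ and all its subsystems of size $3$ have the same nonempty signature. \textbf{Theorem.} Let $S$ be a regular system. \begin{enumerate} \item If $S$ is $2$-crossing, then $S$ is upper convex or exactly $2$ paths appear on the upper envelope of $S$. \item If $S$ is $4$-crossing, then $S$ is upper convex or at most $3$ paths appear on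 the upper envelope of $S$. \item If $S$ is $k$-crossing for some integer $k>4$, then $S$ is upper convex or at most $4$ distinct paths appear on the upper envelope of $S$. \end{enumerate} -/

import Mathlib

open scoped unitInterval Topology

noncomputable section

/-- `f` and `g` cross at `t`: they meet there, and one of them passes from below to above the
other. -/
def CrossAt (f g : C(I, ℝ)) (t : I) : Prop :=
  f t = g t ∧
    (((∀ᶠ s in 𝓝[<] t, f s < g s) ∧ (∀ᶠ s in 𝓝[>] t, g s < f s)) ∨
      ((∀ᶠ s in 𝓝[<] t, g s < f s) ∧ (∀ᶠ s in 𝓝[>] t, f s < g s)))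

/-- A system of paths. A path, the graph of a continuous function on `[0, 1]`, is represented by
that function. -/
structure PathSystem where
  paths : Finset C(I, ℝ)
  three_le_card : 3 ≤ paths.card
  left_ne : ∀ f ∈ paths, ∀ g ∈ paths, f ≠ g → f 0 ≠ g 0
  right_ne : ∀ f ∈ paths, ∀ g ∈ paths, f ≠ g → f 1 ≠ g 1
  finite_inter : ∀ f ∈ paths, ∀ g ∈ paths, f ≠ g → {t : I | f t = g t}.Finite
  cross : ∀ f ∈ paths, ∀ g ∈ paths, f ≠ g → ∀ t : I, f t = g t → CrossAt f g t
  no_triple : ∀ f ∈ paths, ∀ g ∈ paths, ∀ h ∈ paths, f ≠ g → f ≠ h → g ≠ h →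
    ∀ t : I, ¬ (f t = g t ∧ g t = h t)

namespace PathSystem

/-- The number of paths. -/
def size (S : PathSystem) : ℕ := S.paths.card

/-- `T` is a subsystem of `S` (that `T` has at least three paths is part of being a system). -/
def IsSubsystem (T S : PathSystem) : Prop := T.paths ⊆ S.paths

/-- Each pair of paths crosses at least once and at most `k` times. -/
def IsCrossing (S : PathSystem) (k : ℕ) : Prop :=
  ∀ f ∈ S.paths, ∀ g ∈ S.paths, f ≠ g →
    1 ≤ {t : I | CrossAt f g t}.ncard ∧ {t : I | CrossAt f g t}.ncard ≤ k

open Classical in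
/-- The paths which at some point lie above every other path of the system. -/
def upperEnvelope (S : PathSystem) : Finset C(I, ℝ) :=
  S.paths.filter fun f => ∃ t : I, ∀ g ∈ S.paths, g ≠ f → g t < f t

/-- All paths of the system appear on the upper envelope. -/
def UpperConvex (S : PathSystem) : Prop := S.upperEnvelope = S.paths

open Classical in
/-- The paths are labelled `1, 2, …, n` by the order of their left endpoints from bottom to
top. -/
def label (S : PathSystem) (f : C(I, ℝ)) : ℕ :=
  (S.paths.filter fun g => g 0 ≤ f 0).card

/-- The times at which some two distinct paths of the system cross. -/
def crossingSet (S : PathSystem) : Set I :=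
  {t | ∃ f ∈ S.paths, ∃ g ∈ S.paths, f ≠ g ∧ CrossAt f g t}

theorem finite_crossingSet (S : PathSystem) : S.crossingSet.Finite := by
  have h : S.crossingSet ⊆
      ⋃ p ∈ {p : C(I, ℝ) × C(I, ℝ) | p ∈ (S.paths ×ˢ S.paths : Finset _) ∧ p.1 ≠ p.2},
        {t : I | p.1 t = p.2 t} := by
    rintro t ⟨f, hf, g, hg, hfg, ht⟩
    simp only [Set.mem_iUnion]
    exact ⟨(f, g), ⟨Finset.mem_product.2 ⟨hf, hg⟩, hfg⟩, ht.1⟩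
  refine Set.Finite.subset (Set.Finite.biUnion ?_ ?_) h
  · exact (S.paths ×ˢ S.paths).finite_toSet.subset fun p hp => hp.1
  · rintro p ⟨hp, hne⟩
    exact S.finite_inter _ (Finset.mem_product.1 hp).1 _ (Finset.mem_product.1 hp).2 hne

/-- The crossing times, listed from left to right. -/
def crossingTimes (S : PathSystem) : List I :=
  S.finite_crossingSet.toFinset.sort (· ≤ ·)

open Classical in
/-- The labels of the paths which take part in a crossing at time `t`. -/
def crossingLabels (S : PathSystem) (t : I) : Finset ℕ :=
  (S.paths.filter fun f => ∃ g ∈ S.paths, f ≠ g ∧ CrossAt f g t).image S.label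

end PathSystem

/-- The alphabet of signatures. -/
inductive SigLetter
  | x
  | y
  | z

namespace PathSystem

/-- For a system of size 3, the letter of the crossing at time `t`; only one pair of
paths crosses at a time there, and the pairs `{1, 2}`, `{1, 3}`, `{2, 3}` give `x`, `y`, `z`. -/
def crossingLetter (S : PathSystem) (t : I) : SigLetter :=
  if S.crossingLabels t = {1, 2} then .x
  else if S.crossingLabels t = {1, 3} then .y
  else .z

/-- The signature of a system of size 3 (it is used for such systems only). -/
def signature (S : PathSystem) : List SigLetter :=
  S.crossingTimes.map S.crossingLetter

/-- A system is regular if it has size at least 4 and all its subsystems of size 3 have the same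
nonempty signature. -/
def IsRegular (S : PathSystem) : Prop :=
  4 ≤ S.size ∧
    ∀ T T' : PathSystem, T.IsSubsystem S → T'.IsSubsystem S → T.size = 3 → T'.size = 3 →
      T.signature = T'.signature ∧ T.signature ≠ []

end PathSystem

end

/-! Label the paths by their left endpoints and count crossings. Meeting paths swap, so at a time
without meetings path `i` is above path `j > i` exactly when they have crossed an odd number of
times. Hence `i` is on top when its counts with all higher labels are odd and with all lower labels
even. By regularity, the joint counts occurring in a triple `i < j < k` are the prefix counts of one
word, the same for all triples.

The times at which a count has a given value form an interval. By Helly's theorem on the line,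
prescribed counts of one path with several others are attained together once any two of them are
(`IsCounting.exists_common`). So if there are an even `A` and an odd `B` with joint counts `(A, A)`
below, `(B, B)` above and `(A, B)` across (`Universal`), every path appears on top.

Conversely, let a path with two labels below it and two above it appear. By
`IsCounting.diag_or_diag` its counts on one side can be made equal without disturbing the other side
(`IsCounting.exists_constant_side`); doing so on both sides yields `Universal`. Thus, without upper
convexity, only the first two and the last two paths can appear, which gives the bound 4. With at
most 4 crossings per pair, parity and the shape of the word stop the second and the next-to-last
path from both appearing; with at most 2, only two paths remain. Two paths always appear, since the
initial top path is overtaken. -/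

/-! ### Helly arguments for counting functions on a line. -/

section Helly

variable {D ι : Type*} [LinearOrder D]

/-- A monotone counting function, all of whose superlevel sets have a least element. -/
structure IsCounting (u : D → ℕ) : Prop where
  mono : Monotone u
  least : ∀ t a, a ≤ u t → ∃ s, IsLeast {s | a ≤ u s} s

/-- One-dimensional Helly theorem for level sets of counting functions. -/
theorem IsCounting.exists_common [Nonempty D] (s : Finset ι) (u : ι → D → ℕ) (a : ι → ℕ)
    (hu : ∀ p ∈ s, IsCounting (u p))
    (h : ∀ p ∈ s, ∀ q ∈ s, ∃ t, a p ≤ u p t ∧ u q t ≤ a q) :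
    ∃ t, ∀ p ∈ s, u p t = a p := by
  classical
  rcases s.eq_empty_or_nonempty with rfl | hs
  · exact ⟨Classical.arbitrary D, by simp⟩
  have hl : ∀ p : s, ∃ t, IsLeast {t | a p ≤ u p t} t := fun p => by
    obtain ⟨t, ht, -⟩ := h p p.2 p p.2
    exact (hu p p.2).least t _ ht
  choose τ hτ using hl
  -- The common time is the latest of the first times at which the counts reach their targets. No
  -- count has overshot there, by the pairwise hypothesis with `p`.
  obtain ⟨p, -, hp⟩ := s.attach.exists_max_image τ (by simpa using hs)
  refine ⟨τ p, fun q hq => le_antisymm ?_ ?_⟩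
  · obtain ⟨t, ht, ht'⟩ := h p p.2 q hq
    exact ((hu q hq).mono ((hτ p).2 ht)).trans ht'
  · exact (hτ ⟨q, hq⟩).1.trans ((hu q hq).mono (hp ⟨q, hq⟩ (by simp)))

theorem IsCounting.exists_common_pair [Nonempty D] {u v : D → ℕ} (hu : IsCounting u)
    (hv : IsCounting v) {p q : ℕ} (h₁ : ∃ t, p ≤ u t ∧ v t ≤ q) (h₂ : ∃ t, q ≤ v t ∧ u t ≤ p)
    (h₃ : ∃ t, u t = p) (h₄ : ∃ t, v t = q) : ∃ t, u t = p ∧ v t = q := by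
  obtain ⟨t, ht⟩ := IsCounting.exists_common (Finset.univ : Finset Bool)
    (fun b => if b then u else v) (fun b => if b then p else q)
    (by rintro (_ | _) - <;> simpa)
    (by
      obtain ⟨t₃, rfl⟩ := h₃
      obtain ⟨t₄, rfl⟩ := h₄
      rintro (_ | _) - (_ | _) -
      · exact ⟨t₄, by simp⟩
      · simpa using h₂
      · simpa using h₁
      · exact ⟨t₃, by simp⟩)
  exact ⟨t, by simpa using ht true, by simpa using ht false⟩

/-- At a time `t` with `u t = p` and `w t = q`, put `r = v t`. If neither diagonal value occurs,
Helly for two functions forces `q < r < p`, and induction on the gap, applied to `(p, r)`, gives `R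
r r`. But `u` takes the value `r` only before `t`, and `w` only after `t`. -/
theorem IsCounting.diag_of_lt [Nonempty D] {u v w : D → ℕ} (hu : IsCounting u)
    (hv : IsCounting v) {R : ℕ → ℕ → Prop}
    (huv : ∀ p q, R p q ↔ ∃ t, u t = p ∧ v t = q) (huw : ∀ p q, R p q ↔ ∃ t, u t = p ∧ w t = q)
    (hvw : ∀ p q, R p q ↔ ∃ t, v t = p ∧ w t = q) (hum : Monotone u) (hwm : Monotone w) :
    ∀ d p q, p = q + d → R p q → R p p ∨ R q q := by
  intro d
  induction d using Nat.strong_induction_on with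
  | _ d ih =>
    intro p q hd hpq
    by_contra! hcon
    obtain ⟨hp, hq⟩ := hcon
    obtain ⟨t, htu, htw⟩ := (huw p q).1 hpq
    obtain ⟨r, hr⟩ : ∃ r, v t = r := ⟨_, rfl⟩
    have hpr : R p r := (huv p r).2 ⟨t, htu, hr⟩
    have hrq : R r q := (hvw r q).2 ⟨t, hr, htw⟩
    have hv_p : ∃ s, v s = p := let ⟨s, hs, _⟩ := (hvw p q).1 hpq; ⟨s, hs⟩
    have hv_q : ∃ s, v s = q := let ⟨s, _, hs⟩ := (huv p q).1 hpq; ⟨s, hs⟩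
    obtain ⟨s, hsu, hsv⟩ := (huv p q).1 hpq
    have hrp : r < p := by
      by_contra! hle
      refine hp ((huv p p).2 (hu.exists_common_pair hv ⟨s, by omega, by omega⟩
        ⟨t, by omega, by omega⟩ ⟨t, htu⟩ hv_p))
    have hqr : q < r := by
      by_contra! hle
      obtain ⟨s', hs'u, hs'v⟩ := (huv r q).1 hrq
      rcases Nat.eq_or_lt_of_le hle with rfl | hlt
      · exact hq hrq
      have hu_q : ∃ s, u s = q := by
        obtain ⟨x, hx⟩ := hv_q
        obtain ⟨y, hy, -⟩ := (huv q (w x)).1 ((hvw q (w x)).2 ⟨x, hx, rfl⟩)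
        exact ⟨y, hy⟩
      refine hq ((huv q q).2 (hu.exists_common_pair hv ⟨s, by omega, by omega⟩
        ⟨s', by omega, by omega⟩ hu_q hv_q))
    rcases ih (p - r) (by omega) p r (by omega) hpr with h | h
    · exact hp h
    obtain ⟨t₁, h₁u, h₁w⟩ := (huw r r).1 h
    rcases le_total t t₁ with hle | hle
    · have := hum hle; omega
    · have := hwm hle; omega

/-- Three counting functions with the same joint values: any joint value `(p, q)` forces one of the
diagonal joint values `(p, p)` and `(q, q)`. -/
theorem IsCounting.diag_or_diag [Nonempty D] {u v w : D → ℕ} (hu : IsCounting u)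
    (hv : IsCounting v) (hw : IsCounting w) {R : ℕ → ℕ → Prop}
    (huv : ∀ p q, R p q ↔ ∃ t, u t = p ∧ v t = q) (huw : ∀ p q, R p q ↔ ∃ t, u t = p ∧ w t = q)
    (hvw : ∀ p q, R p q ↔ ∃ t, v t = p ∧ w t = q) {p q : ℕ} (h : R p q) : R p p ∨ R q q := by
  rcases le_total q p with hqp | hpq
  · obtain ⟨d, rfl⟩ := Nat.exists_eq_add_of_le hqp
    exact hu.diag_of_lt hv huv huw hvw hu.mono hw.mono d _ _ rfl h
  · obtain ⟨d, rfl⟩ := Nat.exists_eq_add_of_le hpq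
    -- Reversing the order of the three functions and transposing `R` exchanges the two cases.
    exact (hw.diag_of_lt hv (R := fun a b => R b a) (fun a b => by rw [hvw]; tauto)
      (fun a b => by rw [huw]; tauto) (fun a b => by rw [huv]; tauto)
      hw.mono hu.mono d _ _ rfl h).symm

/-- The counts of the functions in `A` can be made equal while keeping the counts in `C`. -/
theorem IsCounting.exists_constant_side [Nonempty D] (A C : Finset ι) (u : ι → D → ℕ)
    (hu : ∀ i, IsCounting (u i)) (Bd : ℕ → Prop) (hA : A.Nonempty) (hAC : Disjoint A C)
    (hBd : ∀ j ∈ A, ∀ k ∈ A, ∀ s, u j s ≠ u k s → Bd (u j s) ∨ Bd (u k s))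
    (hdiag : ∀ p, Bd p → ∀ j ∈ A, ∀ k ∈ A, ∃ s, u j s = p ∧ u k s = p)
    (hunif : ∀ h ∈ C, ∀ j ∈ A, ∀ k ∈ A, ∀ t, ∃ t', u h t' = u h t ∧ u k t' = u j t) (t : D) :
    ∃ t', ∃ j₀ ∈ A, (∀ j ∈ A, u j t' = u j₀ t) ∧ ∀ h ∈ C, u h t' = u h t := by
  classical
  obtain ⟨j, hj, hjmax⟩ := A.exists_max_image (u · t) hA
  obtain ⟨k, hk, hkmin⟩ := A.exists_min_image (u · t) hA
  by_cases hjk : u j t = u k t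
  · exact ⟨t, j, hj, fun l hl => le_antisymm (hjmax l hl) (hjk ▸ hkmin l hl), fun _ _ => rfl⟩
  -- The extreme counts differ, so one of them is a diagonal value. It becomes the common target for
  -- `A`, while each function in `C` keeps its value at `t` as target.
  obtain ⟨l, hl, hBl⟩ : ∃ l ∈ A, Bd (u l t) := by
    rcases hBd j hj k hk t hjk with h | h
    exacts [⟨j, hj, h⟩, ⟨k, hk, h⟩]
  have key : ∀ i ∈ A ∪ C, ∀ i' ∈ A ∪ C, ∃ s,
      (if i ∈ C then u i t else u l t) ≤ u i s ∧ u i' s ≤ (if i' ∈ C then u i' t else u l t) := by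
    intro i hi i' hi'
    by_cases hiC : i ∈ C <;> by_cases hiC' : i' ∈ C
    · exact ⟨t, by simp [hiC, hiC']⟩
    · have hi'A : i' ∈ A := by simpa [hiC'] using hi'
      obtain ⟨s, h₁, h₂⟩ := hunif i hiC l hl i' hi'A t
      exact ⟨s, by simp [hiC, h₁], by simp [hiC', h₂]⟩
    · have hiA : i ∈ A := by simpa [hiC] using hi
      obtain ⟨s, h₁, h₂⟩ := hunif i' hiC' l hl i hiA t
      exact ⟨s, by simp [hiC, h₂], by simp [hiC', h₁]⟩
    · have hi'A : i' ∈ A := by simpa [hiC'] using hi'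
      have hiA : i ∈ A := by simpa [hiC] using hi
      obtain ⟨s, h₁, h₂⟩ := hdiag _ hBl i hiA i' hi'A
      exact ⟨s, by simp [hiC, h₁], by simp [hiC', h₂]⟩
  obtain ⟨t', ht'⟩ := IsCounting.exists_common (A ∪ C) u _ (fun p _ => hu p) key
  refine ⟨t', l, hl, fun i hi => ?_, fun i hi => ?_⟩
  · rw [ht' i (by simp [hi]), if_neg (Finset.disjoint_left.1 hAC hi)]
  · rw [ht' i (by simp [hi]), if_pos hi]

end Helly

/-! ### Crossing counts of a regular family, and when a curve comes to the top. -/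

/-- The crossing counts of a regular family of `n` curves: `N i j t` is the number of crossings
of the curves `i` and `j` up to time `t`, and `(X r, Y r, Z r)`, `r ≤ L`, are the joint counts
which occur in each triple `i < j < k`. -/
structure CrossingCounts (n L m : ℕ) (D : Type*) [LinearOrder D] where
  N : Fin n → Fin n → D → ℕ
  symm : ∀ i j, N i j = N j i
  counting : ∀ i j, IsCounting (N i j)
  X : ℕ → ℕ
  Y : ℕ → ℕ
  Z : ℕ → ℕ
  exists_index : ∀ i j k, i < j → j < k → ∀ t, ∃ r ≤ L,
    N i j t = X r ∧ N i k t = Y r ∧ N j k t = Z r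
  exists_time : ∀ i j k, i < j → j < k → ∀ r ≤ L, ∃ t,
    N i j t = X r ∧ N i k t = Y r ∧ N j k t = Z r
  zero : X 0 = 0 ∧ Y 0 = 0 ∧ Z 0 = 0
  last : X L = m ∧ Y L = m ∧ Z L = m
  step : ∀ r < L, (X (r + 1) = X r + 1 ∧ Y (r + 1) = Y r ∧ Z (r + 1) = Z r) ∨
    (X (r + 1) = X r ∧ Y (r + 1) = Y r + 1 ∧ Z (r + 1) = Z r) ∨
    (X (r + 1) = X r ∧ Y (r + 1) = Y r ∧ Z (r + 1) = Z r + 1)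
  not_even_odd_even : ∀ r ≤ L, Even (X r) → Odd (Y r) → ¬ Even (Z r)
  not_odd_even_odd : ∀ r ≤ L, Odd (X r) → Even (Y r) → ¬ Odd (Z r)

namespace CrossingCounts

variable {n L m : ℕ} {D : Type*} [LinearOrder D] [Nonempty D] (c : CrossingCounts n L m D)

/-- Joint counts of the pairs `{i, j}` and `{i, k}` for `i < j < k`. -/
def XY (p q : ℕ) : Prop := ∃ r ≤ L, c.X r = p ∧ c.Y r = q

/-- Joint counts of the pairs `{i, k}` and `{j, k}` for `i < j < k`. -/
def YZ (p q : ℕ) : Prop := ∃ r ≤ L, c.Y r = p ∧ c.Z r = q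

/-- Joint counts of the pairs `{i, j}` and `{j, k}` for `i < j < k`. -/
def XZ (p q : ℕ) : Prop := ∃ r ≤ L, c.X r = p ∧ c.Z r = q

/-- Curve `i` lies on top at some time. -/
def Appears (i : Fin n) : Prop :=
  ∃ t, (∀ j, i < j → Odd (c.N i j t)) ∧ ∀ j, j < i → Even (c.N i j t)

/-- A joint count which puts every curve on top at some time. -/
def Universal : Prop := ∃ A B, Even A ∧ Odd B ∧ c.YZ A A ∧ c.XY B B ∧ c.XZ A B

omit [Nonempty D] in
theorem xy_iff {i j k : Fin n} (hij : i < j) (hjk : j < k) (p q : ℕ) :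
    c.XY p q ↔ ∃ t, c.N i j t = p ∧ c.N i k t = q := by
  constructor
  · rintro ⟨r, hr, rfl, rfl⟩
    obtain ⟨t, h₁, h₂, -⟩ := c.exists_time i j k hij hjk r hr
    exact ⟨t, h₁, h₂⟩
  · rintro ⟨t, rfl, rfl⟩
    obtain ⟨r, hr, h₁, h₂, -⟩ := c.exists_index i j k hij hjk t
    exact ⟨r, hr, h₁.symm, h₂.symm⟩

omit [Nonempty D] in
theorem yz_iff {i j k : Fin n} (hij : i < j) (hjk : j < k) (p q : ℕ) :
    c.YZ p q ↔ ∃ t, c.N k i t = p ∧ c.N k j t = q := by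
  rw [c.symm k i, c.symm k j]
  constructor
  · rintro ⟨r, hr, rfl, rfl⟩
    obtain ⟨t, -, h₁, h₂⟩ := c.exists_time i j k hij hjk r hr
    exact ⟨t, h₁, h₂⟩
  · rintro ⟨t, rfl, rfl⟩
    obtain ⟨r, hr, -, h₁, h₂⟩ := c.exists_index i j k hij hjk t
    exact ⟨r, hr, h₁.symm, h₂.symm⟩

omit [Nonempty D] in
theorem xz_iff {i j k : Fin n} (hij : i < j) (hjk : j < k) (p q : ℕ) :
    c.XZ p q ↔ ∃ t, c.N j i t = p ∧ c.N j k t = q := by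
  rw [c.symm j i]
  constructor
  · rintro ⟨r, hr, rfl, rfl⟩
    obtain ⟨t, h₁, -, h₂⟩ := c.exists_time i j k hij hjk r hr
    exact ⟨t, h₁, h₂⟩
  · rintro ⟨t, rfl, rfl⟩
    obtain ⟨r, hr, h₁, -, h₂⟩ := c.exists_index i j k hij hjk t
    exact ⟨r, hr, h₁.symm, h₂.symm⟩

theorem xy_diag_or_diag (hn : 4 ≤ n) {p q : ℕ} (h : c.XY p q) : c.XY p p ∨ c.XY q q := by
  let a : Fin n := ⟨0, by omega⟩
  let b : Fin n := ⟨1, by omega⟩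
  let d : Fin n := ⟨2, by omega⟩
  let e : Fin n := ⟨3, by omega⟩
  have hab : a < b := Fin.mk_lt_mk.2 (by omega)
  have hbd : b < d := Fin.mk_lt_mk.2 (by omega)
  have hde : d < e := Fin.mk_lt_mk.2 (by omega)
  exact IsCounting.diag_or_diag (c.counting a b) (c.counting a d) (c.counting a e)
    (c.xy_iff hab hbd) (c.xy_iff hab (hbd.trans hde)) (c.xy_iff (hab.trans hbd) hde) h

theorem yz_diag_or_diag (hn : 4 ≤ n) {p q : ℕ} (h : c.YZ p q) : c.YZ p p ∨ c.YZ q q := by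
  let a : Fin n := ⟨0, by omega⟩
  let b : Fin n := ⟨1, by omega⟩
  let d : Fin n := ⟨2, by omega⟩
  let e : Fin n := ⟨3, by omega⟩
  have hab : a < b := Fin.mk_lt_mk.2 (by omega)
  have hbd : b < d := Fin.mk_lt_mk.2 (by omega)
  have hde : d < e := Fin.mk_lt_mk.2 (by omega)
  exact IsCounting.diag_or_diag (c.counting e a) (c.counting e b) (c.counting e d)
    (c.yz_iff hab (hbd.trans hde)) (c.yz_iff (hab.trans hbd) hde) (c.yz_iff hbd hde) h

omit [Nonempty D] in
theorem exists_upper_diag {i j k : Fin n} (hi : i.1 + 2 < n) (hj : i < j) (hk : i < k) {p : ℕ}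
    (h : c.XY p p) : ∃ t, c.N i j t = p ∧ c.N i k t = p := by
  rcases lt_trichotomy j k with hjk | rfl | hjk
  · exact (c.xy_iff hj hjk p p).1 h
  · by_cases hlast : j.1 + 1 < n
    · obtain ⟨t, ht, -⟩ := (c.xy_iff (k := ⟨j.1 + 1, hlast⟩) hj (Fin.lt_def.2 (by simp)) p p).1 h
      exact ⟨t, ht, ht⟩
    · obtain ⟨t, -, ht⟩ := (c.xy_iff (i := i) (j := ⟨i.1 + 1, by omega⟩) (k := j)
        (Fin.lt_def.2 (by simp)) (Fin.lt_def.2 (by simp; omega)) p p).1 h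
      exact ⟨t, ht, ht⟩
  · obtain ⟨t, h₁, h₂⟩ := (c.xy_iff hk hjk p p).1 h
    exact ⟨t, h₂, h₁⟩

omit [Nonempty D] in
theorem exists_lower_diag {i j k : Fin n} (hi : 2 ≤ i.1) (hj : j < i) (hk : k < i) {p : ℕ}
    (h : c.YZ p p) : ∃ t, c.N i j t = p ∧ c.N i k t = p := by
  rcases lt_trichotomy j k with hjk | rfl | hjk
  · exact (c.yz_iff hjk hk p p).1 h
  · by_cases h0 : 0 < j.1
    · obtain ⟨t, -, ht⟩ := (c.yz_iff (i := ⟨0, by omega⟩) (Fin.lt_def.2 (by simpa)) hj p p).1 h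
      exact ⟨t, ht, ht⟩
    · obtain ⟨t, ht, -⟩ := (c.yz_iff (i := j) (j := ⟨1, by omega⟩) (k := i)
        (Fin.lt_def.2 (by simp; omega)) (Fin.lt_def.2 (by simp; omega)) p p).1 h
      exact ⟨t, ht, ht⟩
  · obtain ⟨t, h₁, h₂⟩ := (c.yz_iff hjk hj p p).1 h
    exact ⟨t, h₂, h₁⟩

/-- The targets are `A` for the curves below `i` and `B` for those above. Two targets are met
together by `YZ A A`, `XZ A B` or `XY B B`, according to the sides; Helly does the rest. -/
theorem Universal.appears (hn : 3 ≤ n) (h : c.Universal) (i : Fin n) : c.Appears i := by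
  obtain ⟨A, B, hA, hB, hYZ, hXY, hXZ⟩ := h
  have hpair : ∀ p q, p ≠ i → q ≠ i → p < q → ∃ t, c.N i p t = (if i < p then B else A) ∧
      c.N i q t = if i < q then B else A := by
    intro p q hp hq hpq
    rcases hp.lt_or_gt with hp | hp <;> rcases hq.lt_or_gt with hq | hq
    · simpa [hp.not_gt, hq.not_gt] using (c.yz_iff hpq hq A A).1 hYZ
    · simpa [hp.not_gt, hq] using (c.xz_iff hp hq A B).1 hXZ
    · exact absurd (hp.trans (hpq.trans hq)) (lt_irrefl _)
    · simpa [hp, hq] using (c.xy_iff hp hpq B B).1 hXY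
  have hpair' : ∀ p q, p ≠ i → q ≠ i → p ≠ q → ∃ t, c.N i p t = (if i < p then B else A) ∧
      c.N i q t = if i < q then B else A := by
    intro p q hp hq hpq
    rcases hpq.lt_or_gt with hpq | hpq
    · exact hpair p q hp hq hpq
    · obtain ⟨t, h₁, h₂⟩ := hpair q p hq hp hpq
      exact ⟨t, h₂, h₁⟩
  obtain ⟨t, ht⟩ := IsCounting.exists_common (Finset.univ.erase i) (c.N i)
    (fun p => if i < p then B else A) (fun p _ => c.counting i p) (by
      intro p hp q hq
      simp only [Finset.mem_erase, Finset.mem_univ, and_true] at hp hq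
      by_cases hpq : p = q
      · subst hpq
        -- A single target is met by pairing `p` with any third curve.
        obtain ⟨k, hk⟩ : ∃ k, k ∉ ({i, p} : Finset (Fin n)) := by
          by_contra! hall
          have : (Finset.univ : Finset (Fin n)).card ≤ ({i, p} : Finset (Fin n)).card :=
            Finset.card_le_card fun x _ => hall x
          have := this.trans Finset.card_le_two
          simp at this
          omega
        simp only [Finset.mem_insert, Finset.mem_singleton, not_or] at hk
        obtain ⟨t, ht, -⟩ := hpair' p k hp hk.1 (Ne.symm hk.2)
        exact ⟨t, ht.ge, ht.le⟩
      · obtain ⟨t, h₁, h₂⟩ := hpair' p q hp hq hpq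
        exact ⟨t, h₁.ge, h₂.le⟩)
  refine ⟨t, fun j hj => ?_, fun j hj => ?_⟩
  · rw [ht j (by simp [hj.ne']), if_pos hj]
    exact hB
  · rw [ht j (by simp [hj.ne]), if_neg hj.not_gt]
    exact hA

/-- The counts below `i` survive because `XZ` does not depend on which upper curve is chosen. -/
theorem exists_upper_constant (hn : 4 ≤ n) {i : Fin n} (hi : i.1 + 2 < n) (t : D) :
    ∃ t', ∃ j₀, i < j₀ ∧ (∀ j, i < j → c.N i j t' = c.N i j₀ t) ∧
      ∀ h, h < i → c.N i h t' = c.N i h t := by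
  obtain ⟨t', j₀, hj₀, h₁, h₂⟩ := IsCounting.exists_constant_side (Finset.Ioi i) (Finset.Iio i)
    (c.N i) (c.counting i) (fun p => c.XY p p)
    ⟨⟨i.1 + 1, by omega⟩, by simp [Fin.lt_def]⟩
    (Finset.disjoint_left.2 fun x hx hx' => by
      simp only [Finset.mem_Ioi, Finset.mem_Iio] at hx hx'
      exact lt_asymm hx hx')
    (by
      intro j hj k hk s hne
      simp only [Finset.mem_Ioi] at hj hk
      rcases lt_trichotomy j k with hjk | rfl | hjk
      · exact c.xy_diag_or_diag hn ((c.xy_iff hj hjk _ _).2 ⟨s, rfl, rfl⟩)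
      · exact absurd rfl hne
      · exact (c.xy_diag_or_diag hn ((c.xy_iff hk hjk _ _).2 ⟨s, rfl, rfl⟩)).symm)
    (by
      intro p hp j hj k hk
      simp only [Finset.mem_Ioi] at hj hk
      exact c.exists_upper_diag hi hj hk hp)
    (by
      intro h hh j hj k hk s
      simp only [Finset.mem_Ioi, Finset.mem_Iio] at hj hk hh
      exact (c.xz_iff hh hk _ _).1 ((c.xz_iff hh hj _ _).2 ⟨s, rfl, rfl⟩)) t
  exact ⟨t', j₀, by simpa using hj₀, by simpa using h₁, by simpa using h₂⟩

theorem exists_lower_constant (hn : 4 ≤ n) {i : Fin n} (hi : 2 ≤ i.1) (t : D) :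
    ∃ t', ∃ j₀, j₀ < i ∧ (∀ j, j < i → c.N i j t' = c.N i j₀ t) ∧
      ∀ h, i < h → c.N i h t' = c.N i h t := by
  obtain ⟨t', j₀, hj₀, h₁, h₂⟩ := IsCounting.exists_constant_side (Finset.Iio i) (Finset.Ioi i)
    (c.N i) (c.counting i) (fun p => c.YZ p p)
    ⟨⟨0, by omega⟩, by simp [Fin.lt_def]; omega⟩
    (Finset.disjoint_left.2 fun x hx hx' => by
      simp only [Finset.mem_Ioi, Finset.mem_Iio] at hx hx'
      exact lt_asymm hx hx')
    (by
      intro j hj k hk s hne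
      simp only [Finset.mem_Iio] at hj hk
      rcases lt_trichotomy j k with hjk | rfl | hjk
      · exact c.yz_diag_or_diag hn ((c.yz_iff hjk hk _ _).2 ⟨s, rfl, rfl⟩)
      · exact absurd rfl hne
      · exact (c.yz_diag_or_diag hn ((c.yz_iff hjk hj _ _).2 ⟨s, rfl, rfl⟩)).symm)
    (by
      intro p hp j hj k hk
      simp only [Finset.mem_Iio] at hj hk
      exact c.exists_lower_diag hi hj hk hp)
    (by
      intro h hh j hj k hk s
      simp only [Finset.mem_Ioi, Finset.mem_Iio] at hj hk hh
      obtain ⟨t', h₁, h₂⟩ := (c.xz_iff hk hh _ _).1 ((c.xz_iff hj hh _ _).2 ⟨s, rfl, rfl⟩)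
      exact ⟨t', h₂, h₁⟩) t
  exact ⟨t', j₀, by simpa using hj₀, by simpa using h₁, by simpa using h₂⟩

omit [Nonempty D] in
theorem xy_diag_of_const {i : Fin n} (hi : i.1 + 2 < n) {t : D} {B : ℕ}
    (h : ∀ j, i < j → c.N i j t = B) : c.XY B B := by
  have h₁ : i < (⟨i.1 + 1, by omega⟩ : Fin n) := by simp [Fin.lt_def]
  have h₂ : (⟨i.1 + 1, by omega⟩ : Fin n) < ⟨i.1 + 2, by omega⟩ := by simp
  exact (c.xy_iff h₁ h₂ B B).2 ⟨t, h _ h₁, h _ (h₁.trans h₂)⟩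

omit [Nonempty D] in
theorem yz_diag_of_const {i : Fin n} (hi : 2 ≤ i.1) {t : D} {A : ℕ}
    (h : ∀ j, j < i → c.N i j t = A) : c.YZ A A := by
  have h₁ : (⟨0, by omega⟩ : Fin n) < ⟨1, by omega⟩ := by simp
  have h₂ : (⟨1, by omega⟩ : Fin n) < i := Fin.lt_def.2 (by simpa)
  exact (c.yz_iff h₁ h₂ A A).2 ⟨t, h _ (h₁.trans h₂), h _ h₂⟩

/-- A curve with at least two curves above it at the left end which appears on top does so at a
time when it has crossed all these curves equally often. -/
theorem Appears.upper (hn : 4 ≤ n) {i : Fin n} (hi : i.1 + 2 < n) (h : c.Appears i) :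
    ∃ B, Odd B ∧ c.XY B B ∧ ∃ t, (∀ j, i < j → c.N i j t = B) ∧
      ∀ j, j < i → Even (c.N i j t) := by
  obtain ⟨t, h₁, h₂⟩ := h
  obtain ⟨t', j₀, hj₀, h₃, h₄⟩ := c.exists_upper_constant hn hi t
  exact ⟨_, h₁ j₀ hj₀, c.xy_diag_of_const hi h₃, t', h₃, fun j hj => h₄ j hj ▸ h₂ j hj⟩

theorem Appears.lower (hn : 4 ≤ n) {i : Fin n} (hi : 2 ≤ i.1) (h : c.Appears i) :
    ∃ A, Even A ∧ c.YZ A A ∧ ∃ t, (∀ j, j < i → c.N i j t = A) ∧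
      ∀ j, i < j → Odd (c.N i j t) := by
  obtain ⟨t, h₁, h₂⟩ := h
  obtain ⟨t', j₀, hj₀, h₃, h₄⟩ := c.exists_lower_constant hn hi t
  exact ⟨_, h₂ j₀ hj₀, c.yz_diag_of_const hi h₃, t', h₃, fun j hj => h₄ j hj ▸ h₁ j hj⟩

/-- Equalize the counts above, then those below; the second change keeps the common value `B` above.
-/
theorem Appears.universal (hn : 4 ≤ n) {i : Fin n} (hi : 2 ≤ i.1) (hi' : i.1 + 2 < n)
    (h : c.Appears i) : c.Universal := by
  obtain ⟨B, hB, hXY, t, h₁, h₂⟩ := h.upper c hn hi'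
  obtain ⟨t', j₀, hj₀, h₃, h₄⟩ := c.exists_lower_constant hn hi t
  refine ⟨_, B, h₂ j₀ hj₀, hB, c.yz_diag_of_const hi h₃, hXY,
    (c.xz_iff (k := ⟨i.1 + 1, by omega⟩) hj₀ (by simp [Fin.lt_def]) _ _).2
      ⟨t', h₃ _ hj₀, ?_⟩⟩
  rw [h₄ _ (by simp [Fin.lt_def]), h₁ _ (by simp [Fin.lt_def])]

end CrossingCounts

/-! ### Combinatorics of the common word. -/

theorem exists_jump (f : ℕ → ℕ) {a b v : ℕ} (hab : a ≤ b) (ha : f a < v) (hb : v ≤ f b) :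
    ∃ r, a ≤ r ∧ r < b ∧ f r < v ∧ v ≤ f (r + 1) := by
  induction b, hab using Nat.le_induction with
  | base => omega
  | succ b hab ih =>
    by_cases h : v ≤ f b
    · obtain ⟨r, h₁, h₂, h₃⟩ := ih h
      exact ⟨r, h₁, by omega, h₃⟩
    · exact ⟨b, hab, by omega, by omega, hb⟩

namespace CrossingCounts

variable {n L m : ℕ} {D : Type*} [LinearOrder D] (c : CrossingCounts n L m D)

theorem word_mono {r s : ℕ} (hrs : r ≤ s) (hs : s ≤ L) :
    c.X r ≤ c.X s ∧ c.Y r ≤ c.Y s ∧ c.Z r ≤ c.Z s := by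
  induction s, hrs using Nat.le_induction with
  | base => simp
  | succ s hrs ih =>
    have := ih (by omega)
    have := c.step s (by omega)
    omega

theorem word_le {r : ℕ} (hr : r ≤ L) : c.X r ≤ m ∧ c.Y r ≤ m ∧ c.Z r ≤ m := by
  have := c.word_mono hr le_rfl
  have := c.last
  omega

theorem yz_last : c.YZ m m := ⟨L, le_rfl, c.last.2.1, c.last.2.2⟩

theorem yz_zero : c.YZ 0 0 := ⟨0, Nat.zero_le _, c.zero.2.1, c.zero.2.2⟩

theorem xz_le {p q : ℕ} (h : c.XZ p q) : p ≤ m ∧ q ≤ m := by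
  obtain ⟨r, hr, rfl, rfl⟩ := h
  exact ⟨(c.word_le hr).1, (c.word_le hr).2.2⟩

theorem xy_le {p q : ℕ} (h : c.XY p q) : p ≤ m ∧ q ≤ m := by
  obtain ⟨r, hr, rfl, rfl⟩ := h
  exact ⟨(c.word_le hr).1, (c.word_le hr).2.1⟩

/-- If the word for `x`, `z` has an `x` between the `b`-th and the next `z`, then the word for
`x`, `y` has a prefix with exactly `b` letters `x` and `b` letters `y`. -/
theorem xy_diag_of_row [Nonempty D] (hn : 4 ≤ n) {a a' b : ℕ} (h : c.XZ a b) (h' : c.XZ a' b)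
    (hne : a < a') : c.XY b b := by
  let i₀ : Fin n := ⟨0, by omega⟩
  let i₁ : Fin n := ⟨1, by omega⟩
  let i₂ : Fin n := ⟨2, by omega⟩
  let i₃ : Fin n := ⟨3, by omega⟩
  have h01 : i₀ < i₁ := Fin.mk_lt_mk.2 (by omega)
  have h12 : i₁ < i₂ := Fin.mk_lt_mk.2 (by omega)
  have h23 : i₂ < i₃ := Fin.mk_lt_mk.2 (by omega)
  obtain ⟨t₂, ht₂, hb₂⟩ := (c.xz_iff h01 h12 _ _).1 h
  obtain ⟨t₃, ht₃, hb₃⟩ := (c.xz_iff h01 (h12.trans h23) _ _).1 h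
  obtain ⟨s₂, hs₂, hd₂⟩ := (c.xz_iff h01 h12 _ _).1 h'
  obtain ⟨s₃, hs₃, hd₃⟩ := (c.xz_iff h01 (h12.trans h23) _ _).1 h'
  have hlt : ∀ t s, c.N i₁ i₀ t = a → c.N i₁ i₀ s = a' → t ≤ s := fun t s ht hs => by
    by_contra! hst
    have := (c.counting i₁ i₀).mono hst.le
    omega
  -- Both level sets at `b` contain an interval leading from a time when `N i₁ i₀` is `a` to one
  -- when it is `a'`. Any two such intervals overlap.
  refine (c.xy_iff h12 h23 b b).2 ((c.counting i₁ i₂).exists_common_pair (c.counting i₁ i₃)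
    ⟨s₃, ?_, hd₃.le⟩ ⟨s₂, ?_, hd₂.le⟩ ⟨t₂, hb₂⟩ ⟨t₃, hb₃⟩)
  · exact hb₂.ge.trans ((c.counting _ _).mono (hlt _ _ ht₂ hs₃))
  · exact hb₃.ge.trans ((c.counting _ _).mono (hlt _ _ ht₃ hs₂))

theorem yz_diag_of_column [Nonempty D] (hn : 4 ≤ n) {a b b' : ℕ} (h : c.XZ a b)
    (h' : c.XZ a b') (hne : b < b') : c.YZ a a := by
  let i₀ : Fin n := ⟨0, by omega⟩
  let i₁ : Fin n := ⟨1, by omega⟩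
  let i₂ : Fin n := ⟨2, by omega⟩
  let i₃ : Fin n := ⟨3, by omega⟩
  have h01 : i₀ < i₁ := Fin.mk_lt_mk.2 (by omega)
  have h12 : i₁ < i₂ := Fin.mk_lt_mk.2 (by omega)
  have h23 : i₂ < i₃ := Fin.mk_lt_mk.2 (by omega)
  obtain ⟨t₀, hb₀, ht₀⟩ := (c.xz_iff (h01.trans h12) h23 _ _).1 h
  obtain ⟨t₁, hb₁, ht₁⟩ := (c.xz_iff h12 h23 _ _).1 h
  obtain ⟨s₀, hd₀, hs₀⟩ := (c.xz_iff (h01.trans h12) h23 _ _).1 h'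
  obtain ⟨s₁, hd₁, hs₁⟩ := (c.xz_iff h12 h23 _ _).1 h'
  have hlt : ∀ t s, c.N i₂ i₃ t = b → c.N i₂ i₃ s = b' → t ≤ s := fun t s ht hs => by
    by_contra! hst
    have := (c.counting i₂ i₃).mono hst.le
    omega
  refine (c.yz_iff h01 h12 a a).2 ((c.counting i₂ i₀).exists_common_pair (c.counting i₂ i₁)
    ⟨s₁, ?_, hd₁.le⟩ ⟨s₀, ?_, hd₀.le⟩ ⟨t₀, hb₀⟩ ⟨t₁, hb₁⟩)
  · exact hb₀.ge.trans ((c.counting _ _).mono (hlt _ _ ht₀ hs₁))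
  · exact hb₁.ge.trans ((c.counting _ _).mono (hlt _ _ ht₁ hs₀))

/-- Otherwise exactly one `x` precedes the third `z`; parity and the absence of `XY 1 1` give three
letters `y` there. Before the first `x` there are two `z` and an even number of `y`, hence none, as
`YZ 2 2` is excluded. In between, `Z` stays 2 while `Y` climbs from 0 to 3, producing `YZ 2 2`. -/
theorem xz_zero_three [Nonempty D] (hn : 4 ≤ n) (hm : m ≤ 4) (h01 : c.XZ 0 1)
    (h23 : c.XZ 2 3) (hXY : ¬ c.XY 1 1) (hYZ : ¬ c.YZ 2 2) : c.XZ 0 3 := by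
  by_contra hXZ
  obtain ⟨r₁, hr₁, hx₁, hz₁⟩ := h01
  obtain ⟨r₂, hr₂, hx₂, hz₂⟩ := id h23
  have hz0 := c.zero.2.2
  have hx0 := c.zero.1
  obtain ⟨r, -, hr, hzr, hzr'⟩ := exists_jump c.Z (Nat.zero_le r₂) (v := 3) (by omega) (by omega)
  have hstep := c.step r (by omega)
  have hle := c.word_mono (r := r + 1) (s := r₂) (by omega) hr₂
  have hX0 : c.X r ≠ 0 := fun h => hXZ ⟨r + 1, by omega, by omega, by omega⟩
  have hX2 : c.X r ≠ 2 := fun h =>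
    hYZ (c.yz_diag_of_column hn (b := 2) ⟨r, by omega, h, by omega⟩ h23 (by omega))
  have hX : c.X r = 1 := by omega
  have hYodd : Odd (c.Y r) := by
    by_contra hY
    have hY' : Even (c.Y (r + 1)) := by
      rw [show c.Y (r + 1) = c.Y r by omega]
      exact Nat.not_odd_iff_even.1 hY
    exact c.not_odd_even_odd (r + 1) (by omega) ⟨0, by omega⟩ hY' ⟨1, by omega⟩
  have hY1 : c.Y r ≠ 1 := fun h => hXY ⟨r, by omega, hX, h⟩
  obtain ⟨s, -, hs, hxs, hxs'⟩ := exists_jump c.X (Nat.zero_le r) (v := 1) (by omega) (by omega)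
  have hstep' := c.step s (by omega)
  have hsr := c.word_mono (r := s + 1) (s := r) (by omega) (by omega)
  have hr₁s : r₁ ≤ s := by
    by_contra! h
    have := c.word_mono (r := s + 1) (s := r₁) (by omega) hr₁
    omega
  have hr₁s' := c.word_mono hr₁s (by omega)
  have hZ1 : c.Z s ≠ 1 := fun h => hXY (c.xy_diag_of_row hn (a := 0) (a' := 1)
    ⟨s, by omega, by omega, h⟩ ⟨s + 1, by omega, by omega, by omega⟩ (by omega))
  have hZ2 : c.Z s = 2 := by omega
  have hYs : Even (c.Y s) := by
    by_contra hY
    exact c.not_even_odd_even s (by omega) ⟨0, by omega⟩ (Nat.not_even_iff_odd.1 hY) ⟨1, by omega⟩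
  have hY2 : c.Y s ≠ 2 := fun h => hYZ ⟨s, by omega, h, hZ2⟩
  have hYr := (c.word_le (r := r) (by omega)).2.1
  obtain ⟨k, hk⟩ := hYodd
  obtain ⟨l, hl⟩ := hYs
  obtain ⟨w, hw₁, hw₂, hw₃, hw₄⟩ := exists_jump c.Y hs.le (v := 2) (by omega) (by omega)
  have hstep'' := c.step w (by omega)
  have := c.word_mono (r := s) (s := w + 1) (by omega) (by omega)
  have := c.word_mono (r := w + 1) (s := r) (by omega) (by omega)
  exact hYZ ⟨w + 1, by omega, by omega, by omega⟩

/-- This is the argument of `xz_zero_three` with the word read backwards: between the second `z` and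
the last `x`, `Y` must pass 2 while `Z` is 2. -/
theorem xz_four_one [Nonempty D] (hn : 4 ≤ n) (hm : m ≤ 4) (h43 : c.XZ 4 3)
    (h21 : c.XZ 2 1) (hXY : ¬ c.XY 3 3) (hYZ : ¬ c.YZ 2 2) : c.XZ 4 1 := by
  by_contra hXZ
  obtain ⟨r₁, hr₁, hx₁, hz₁⟩ := h43
  obtain ⟨r₂, hr₂, hx₂, hz₂⟩ := id h21
  have hr₂₁ : r₂ ≤ r₁ := by
    by_contra! h
    have := c.word_mono h.le hr₂
    omega
  obtain ⟨r, hr₂r, hr, hzr, hzr'⟩ := exists_jump c.Z hr₂₁ (v := 2) (by omega) (by omega)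
  have hstep := c.step r (by omega)
  have hle := c.word_mono hr₂r (by omega)
  have hle' := c.word_mono (r := r + 1) (s := r₁) (by omega) hr₁
  have hX4 : c.X r ≠ 4 := fun h => hXZ ⟨r, by omega, by omega, by omega⟩
  have hX2 : c.X r ≠ 2 := fun h =>
    hYZ (c.yz_diag_of_column hn (b' := 2) h21 ⟨r + 1, by omega, by omega, by omega⟩ (by omega))
  have hX : c.X r = 3 := by omega
  have hYodd : Odd (c.Y r) := by
    by_contra hY
    exact c.not_odd_even_odd r (by omega) ⟨1, by omega⟩ (Nat.not_odd_iff_even.1 hY) ⟨0, by omega⟩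
  have hY3 : c.Y r ≠ 3 := fun h => hXY ⟨r, by omega, hX, h⟩
  have hYr := (c.word_le (r := r) (by omega)).2.1
  obtain ⟨s, hrs, hs, hxs, hxs'⟩ := exists_jump c.X (a := r + 1) (b := r₁) (v := 4)
    (by omega) (by omega) (by omega)
  have hstep' := c.step s (by omega)
  have hsr := c.word_mono hrs (by omega)
  have hsr' := c.word_mono (r := s + 1) (s := r₁) (by omega) (by omega)
  have hZ3 : c.Z s ≠ 3 := fun h => hXY (c.xy_diag_of_row hn (a := 3) (a' := 4)
    ⟨s, by omega, by omega, h⟩ ⟨s + 1, by omega, by omega, by omega⟩ (by omega))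
  have hYs : Even (c.Y s) := by
    by_contra hY
    have hY' : Odd (c.Y (s + 1)) := by
      rw [show c.Y (s + 1) = c.Y s by omega]
      exact Nat.not_even_iff_odd.1 hY
    exact c.not_even_odd_even (s + 1) (by omega) ⟨2, by omega⟩ hY' ⟨1, by omega⟩
  obtain ⟨k, hk⟩ := hYodd
  obtain ⟨l, hl⟩ := hYs
  obtain ⟨w, hw₁, hw₂, hw₃, hw₄⟩ := exists_jump c.Y hrs (v := 2) (by omega) (by omega)
  have hstep'' := c.step w (by omega)
  have := c.word_mono (r := r + 1) (s := w + 1) (by omega) (by omega)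
  have := c.word_mono (r := w + 1) (s := s) (by omega) (by omega)
  exact hYZ ⟨w + 1, by omega, by omega, by omega⟩

/-! ### Bounds on the number of curves that appear. -/

variable [Nonempty D]

/-- One curve below does not suffice for `YZ A A`; the rest of `Universal` remains. -/
theorem Appears.second (hn : 4 ≤ n) {i : Fin n} (hi : 1 ≤ i.1) (hi' : i.1 + 2 < n)
    (h : c.Appears i) : ∃ A B, Even A ∧ Odd B ∧ c.XY B B ∧ c.XZ A B := by
  obtain ⟨B, hB, hXY, t, h₁, h₂⟩ := h.upper c hn hi'
  have hl : (⟨0, by omega⟩ : Fin n) < i := Fin.lt_def.2 (by simpa)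
  have hu : i < (⟨i.1 + 1, by omega⟩ : Fin n) := by simp [Fin.lt_def]
  exact ⟨_, B, h₂ _ hl, hB, hXY, (c.xz_iff hl hu _ _).2 ⟨t, rfl, h₁ _ hu⟩⟩

theorem Appears.penultimate (hn : 4 ≤ n) {i : Fin n} (hi : 2 ≤ i.1) (hi' : i.1 + 1 < n)
    (h : c.Appears i) : ∃ A B, Even A ∧ Odd B ∧ c.YZ A A ∧ c.XZ A B := by
  obtain ⟨A, hA, hYZ, t, h₁, h₂⟩ := h.lower c hn hi
  have hl : (⟨0, by omega⟩ : Fin n) < i := Fin.lt_def.2 (by simp; omega)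
  have hu : i < (⟨i.1 + 1, by omega⟩ : Fin n) := by simp [Fin.lt_def]
  exact ⟨A, _, hA, h₂ _ hu, hYZ, (c.xz_iff hl hu _ _).2 ⟨t, h₁ _ hl, rfl⟩⟩

theorem card_le_four (hn : 4 ≤ n) (hU : ¬ c.Universal) (E : Finset (Fin n))
    (hE : ∀ i ∈ E, c.Appears i) : E.card ≤ 4 := by
  have hsub : E ⊆ {⟨0, by omega⟩, ⟨1, by omega⟩, ⟨n - 2, by omega⟩, ⟨n - 1, by omega⟩} := by
    intro i hi
    have h := mt (fun h : 2 ≤ i.1 ∧ i.1 + 2 < n => (hE i hi).universal c hn h.1 h.2) hU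
    simp only [Finset.mem_insert, Finset.mem_singleton, Fin.ext_iff]
    omega
  exact (Finset.card_le_card hsub).trans Finset.card_le_four

/-- Since `YZ 0 0` and `YZ m m` always hold, failure forces `A = 2`, and `B`, `B'` are 1 and 3 in
some order. Monotonicity along the word leaves two mirror cases, each excluded by a word lemma. -/
theorem universal_of_le_four (hn : 4 ≤ n) (hm : m ≤ 4) {A B A' B' : ℕ} (hA : Even A)
    (hB : Odd B) (hXY : c.XY B B) (hXZ : c.XZ A B) (hA' : Even A') (hB' : Odd B')
    (hYZ : c.YZ A' A') (hXZ' : c.XZ A' B') : c.Universal := by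
  by_contra hU
  have hXY' : ¬ c.XY B' B' := fun h => hU ⟨A', B', hA', hB', hYZ, h, hXZ'⟩
  have hYZ' : ¬ c.YZ A A := fun h => hU ⟨A, B, hA, hB, h, hXY, hXZ⟩
  have hno : ¬ c.XZ A' B := fun h => hU ⟨A', B, hA', hB, hYZ, hXY, h⟩
  have hA0 : A ≠ 0 := fun h => hYZ' (h ▸ c.yz_zero)
  have hAm : A ≠ m := fun h => hYZ' (h ▸ c.yz_last)
  have hBB : B ≠ B' := fun h => hXY' (h ▸ hXY)
  have hAA : A ≠ A' := fun h => hYZ' (h ▸ hYZ)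
  have h₁ := c.xz_le hXZ
  have h₂ := c.xz_le hXZ'
  obtain ⟨r, hr, hx, hz⟩ := id hXZ
  obtain ⟨r', hr', hx', hz'⟩ := id hXZ'
  have hmono : (A ≤ A' ∧ B ≤ B') ∨ (A' ≤ A ∧ B' ≤ B) := by
    rcases le_total r r' with h | h
    · have := c.word_mono h hr'; omega
    · have := c.word_mono h hr; omega
  obtain ⟨a, ha⟩ := hA
  obtain ⟨b, hb⟩ := hB
  obtain ⟨a', ha'⟩ := hA'
  obtain ⟨b', hb'⟩ := hB'
  obtain rfl : A = 2 := by omega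
  have hcase : (A' = 0 ∧ B' = 1 ∧ B = 3) ∨ (A' = 4 ∧ B' = 3 ∧ B = 1) := by omega
  rcases hcase with ⟨rfl, rfl, rfl⟩ | ⟨rfl, rfl, rfl⟩
  · exact hno (c.xz_zero_three hn hm hXZ' hXZ hXY' hYZ')
  · exact hno (c.xz_four_one hn hm hXZ' hXZ hXY' hYZ')

theorem card_le_three (hn : 4 ≤ n) (hm : m ≤ 4) (hU : ¬ c.Universal) (E : Finset (Fin n))
    (hE : ∀ i ∈ E, c.Appears i) (hne : E ≠ Finset.univ) : E.card ≤ 3 := by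
  have hmid : ∀ i ∈ E, ¬ (2 ≤ i.1 ∧ i.1 + 2 < n) := fun i hi h =>
    hU ((hE i hi).universal c hn h.1 h.2)
  rcases hn.eq_or_lt with rfl | hn'
  · have := (Finset.card_lt_iff_ne_univ E).2 hne
    simp at this
    omega
  by_cases h1 : (⟨1, by omega⟩ : Fin n) ∈ E
  · by_cases h2 : (⟨n - 2, by omega⟩ : Fin n) ∈ E
    · obtain ⟨A, B, hA, hB, hXY, hXZ⟩ := (hE _ h1).second c hn le_rfl (by simp; omega)
      obtain ⟨A', B', hA', hB', hYZ, hXZ'⟩ :=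
        (hE _ h2).penultimate c hn (by simp; omega) (by simp; omega)
      exact absurd (c.universal_of_le_four hn hm hA hB hXY hXZ hA' hB' hYZ hXZ') hU
    · have hsub : E ⊆ {⟨0, by omega⟩, ⟨1, by omega⟩, ⟨n - 1, by omega⟩} := by
        intro i hi
        have h := hmid i hi
        have h' : i.1 ≠ n - 2 := fun h' => h2 (by rwa [← show i = ⟨n - 2, by omega⟩ from Fin.ext h'])
        simp only [Finset.mem_insert, Finset.mem_singleton, Fin.ext_iff]
        omega
      exact (Finset.card_le_card hsub).trans Finset.card_le_three
  · have hsub : E ⊆ {⟨0, by omega⟩, ⟨n - 2, by omega⟩, ⟨n - 1, by omega⟩} := by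
      intro i hi
      have h := hmid i hi
      have h' : i.1 ≠ 1 := fun h' => h1 (by rwa [← show i = ⟨1, by omega⟩ from Fin.ext h'])
      simp only [Finset.mem_insert, Finset.mem_singleton, Fin.ext_iff]
      omega
    exact (Finset.card_le_card hsub).trans Finset.card_le_three

/-- An even count is now 0 or `m`, where `YZ` holds on the diagonal anyway, and the only odd count
is 1. So no curve strictly between the first and the next-to-last appears, and these two do not both
appear. -/
theorem card_le_two (hn : 4 ≤ n) (hm : m ≤ 2) (hU : ¬ c.Universal) (E : Finset (Fin n))
    (hE : ∀ i ∈ E, c.Appears i) : E.card ≤ 2 := by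
  have hmid : ∀ i ∈ E, ¬ (1 ≤ i.1 ∧ i.1 + 2 < n) := by
    intro i hi h
    obtain ⟨A, B, hA, hB, hXY, hXZ⟩ := (hE i hi).second c hn h.1 h.2
    refine hU ⟨A, B, hA, hB, ?_, hXY, hXZ⟩
    have := c.xz_le hXZ
    obtain ⟨a, rfl⟩ := hA
    rcases Nat.eq_zero_or_pos a with rfl | ha
    · exact c.yz_zero
    · rw [show a + a = m by omega]
      exact c.yz_last
  by_cases h0 : (⟨0, by omega⟩ : Fin n) ∈ E
  · have hsub : E ⊆ {⟨0, by omega⟩, ⟨n - 1, by omega⟩} := by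
      intro i hi
      have h := hmid i hi
      have h' : i.1 ≠ n - 2 := fun h' => by
        obtain ⟨B, hB, hXY, -⟩ := (hE _ h0).upper c hn (by simp; omega)
        obtain ⟨A', B', hA', hB', hYZ, hXZ'⟩ :=
          (hE _ hi).penultimate c hn (by omega) (by omega)
        have h₁ := c.xy_le hXY
        have h₂ := c.xz_le hXZ'
        obtain ⟨b, hb⟩ := id hB
        obtain ⟨b', hb'⟩ := hB'
        obtain rfl : B' = B := by omega
        exact hU ⟨A', B', hA', hB, hYZ, hXY, hXZ'⟩
      simp only [Finset.mem_insert, Finset.mem_singleton, Fin.ext_iff]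
      omega
    exact (Finset.card_le_card hsub).trans Finset.card_le_two
  · have hsub : E ⊆ {⟨n - 2, by omega⟩, ⟨n - 1, by omega⟩} := by
      intro i hi
      have h := hmid i hi
      have h' : i.1 ≠ 0 := fun h' => h0 (by rwa [← show i = ⟨0, by omega⟩ from Fin.ext h'])
      simp only [Finset.mem_insert, Finset.mem_singleton, Fin.ext_iff]
      omega
    exact (Finset.card_le_card hsub).trans Finset.card_le_two

end CrossingCounts

/-! ### Meetings of two paths and the parity of their number. -/

/-- The number of points up to time `t` in which `f` and `g` meet. -/
noncomputable def meetCount (f g : C(I, ℝ)) (t : I) : ℕ := {s : I | s ≤ t ∧ f s = g s}.ncard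

theorem meetCount_comm (f g : C(I, ℝ)) : meetCount f g = meetCount g f := by
  funext t
  simp only [meetCount, eq_comm]

theorem meetCount_mono {f g : C(I, ℝ)} (hfin : {t | f t = g t}.Finite) :
    Monotone (meetCount f g) := fun _ _ hst =>
  Set.ncard_le_ncard (fun _ hu => ⟨hu.1.trans hst, hu.2⟩) (hfin.subset fun _ hu => hu.2)

theorem meetCount_eq_of_no_meet {f g : C(I, ℝ)} {s t : I} (hst : s ≤ t)
    (h : ∀ u, s < u → u ≤ t → f u ≠ g u) : meetCount f g t = meetCount f g s := by
  unfold meetCount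
  congr 1
  ext u
  exact ⟨fun hu => ⟨not_lt.1 fun hsu => h u hsu hu.1 hu.2, hu.2⟩,
    fun hu => ⟨hu.1.trans hst, hu.2⟩⟩

theorem exists_last_meet {f g : C(I, ℝ)} (hfin : {t | f t = g t}.Finite) {t : I}
    (h : meetCount f g t ≠ 0) :
    ∃ s ≤ t, f s = g s ∧ meetCount f g t = meetCount f g s ∧ ∀ u, s < u → u ≤ t → f u ≠ g u := by
  obtain ⟨s, hs, hmax⟩ := (hfin.subset fun _ hu => hu.2 : {s : I | s ≤ t ∧ f s = g s}.Finite)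
    |>.exists_maximalFor id _ (Set.nonempty_of_ncard_ne_zero h)
  have hno : ∀ u, s < u → u ≤ t → f u ≠ g u := fun u hsu hut hu =>
    hsu.not_ge (hmax ⟨hut, hu⟩ hsu.le)
  exact ⟨s, hs.1, hs.2, meetCount_eq_of_no_meet hs.1 hno, hno⟩

/-- A positive level is first reached at a meeting point, and there are finitely many of these. -/
theorem isCounting_meetCount {f g : C(I, ℝ)} (hfin : {t | f t = g t}.Finite) :
    IsCounting (meetCount f g) := by
  refine ⟨meetCount_mono hfin, fun t a ha => ?_⟩
  rcases Nat.eq_zero_or_pos a with rfl | hpos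
  · exact ⟨⊥, by simp, fun _ _ => bot_le⟩
  have hred : ∀ t, a ≤ meetCount f g t → ∃ s ≤ t, s ∈ {s | f s = g s ∧ a ≤ meetCount f g s} := by
    intro t ht
    obtain ⟨s, hst, hs, hcount, -⟩ := exists_last_meet hfin (t := t) (by omega)
    exact ⟨s, hst, hs, hcount ▸ ht⟩
  obtain ⟨s, -, hs⟩ := hred t ha
  obtain ⟨x, hx, hmin⟩ := (hfin.subset fun _ hu => hu.1 :
    {s | f s = g s ∧ a ≤ meetCount f g s}.Finite).exists_minimalFor id _ ⟨s, hs⟩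
  refine ⟨x, hx.2, fun u hu => ?_⟩
  obtain ⟨v, hvu, hv⟩ := hred u hu
  exact ((le_total x v).elim id fun h => hmin hv h).trans hvu

theorem lt_of_no_meet {f g : C(I, ℝ)} {s t : I} (hst : s ≤ t)
    (h : ∀ u, s ≤ u → u ≤ t → f u ≠ g u) (hs : f s < g s) : f t < g t := by
  by_contra! hle
  obtain ⟨u, hu, hu0⟩ := intermediate_value_Icc hst (f := fun u => f u - g u)
    (by fun_prop : Continuous fun u => f u - g u).continuousOn (show (0 : ℝ) ∈ _ from
      ⟨by linarith, by linarith⟩)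
  exact h u hu.1 hu.2 (by linarith)

theorem eventually_no_meet_left {f g : C(I, ℝ)} (hfin : {t | f t = g t}.Finite) (s : I) :
    ∀ᶠ r in 𝓝[<] s, ∀ u, r ≤ u → u < s → f u ≠ g u := by
  have h : ∀ᶠ r in 𝓝[<] s, ∀ u ∈ {t | f t = g t}, u < s → u < r := by
    rw [Filter.eventually_all_finite hfin]
    intro u _
    by_cases hus : u < s
    · filter_upwards [Ioo_mem_nhdsLT hus] with r hr _ using hr.1
    · exact Filter.Eventually.of_forall fun r h => absurd h hus
  filter_upwards [h] with r hr u hru hus hu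
  exact (hr u hu hus).not_ge hru

theorem eventually_no_meet_right {f g : C(I, ℝ)} (hfin : {t | f t = g t}.Finite) (s : I) :
    ∀ᶠ r in 𝓝[>] s, ∀ u, s < u → u ≤ r → f u ≠ g u := by
  have h : ∀ᶠ r in 𝓝[>] s, ∀ u ∈ {t | f t = g t}, s < u → r < u := by
    rw [Filter.eventually_all_finite hfin]
    intro u _
    by_cases hus : s < u
    · filter_upwards [Ioo_mem_nhdsGT hus] with r hr _ using hr.2
    · exact Filter.Eventually.of_forall fun r h => absurd h hus
  filter_upwards [h] with r hr u hsu hur hu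
  exact (hr u hu hsu).not_ge hur

/-- Induction on the count: the last meeting before `t` is a crossing, which reverses the order, and
just to its left the count is one smaller. -/
theorem lt_iff_even_meetCount {f g : C(I, ℝ)} (hfin : {t | f t = g t}.Finite)
    (hcross : ∀ t, f t = g t → CrossAt f g t) (h0 : f 0 < g 0) (t : I) (ht : f t ≠ g t) :
    f t < g t ↔ Even (meetCount f g t) := by
  obtain ⟨k, hk⟩ : ∃ k, meetCount f g t = k := ⟨_, rfl⟩
  induction k using Nat.strong_induction_on generalizing t with
  | _ k ih =>
    rcases Nat.eq_zero_or_pos k with rfl | hpos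
    · have hno : ∀ u, u ≤ t → f u ≠ g u := fun u hu hfg => by
        have : {s : I | s ≤ t ∧ f s = g s} = ∅ :=
          (Set.ncard_eq_zero (hfin.subset fun _ hu => hu.2)).1 hk
        exact this.subset ⟨hu, hfg⟩
      simp [hk, lt_of_no_meet (s := 0) unitInterval.nonneg' (fun u _ hu => hno u hu) h0]
    obtain ⟨s, hst, hs, hcount, hno⟩ := exists_last_meet hfin (t := t) (by omega)
    have hst' : s < t := hst.lt_of_ne fun h => ht (h ▸ hs)
    have h0s : 0 < s := unitInterval.nonneg'.lt_of_ne fun h => h0.ne (h ▸ hs)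
    have : (𝓝[<] s).NeBot := nhdsLT_neBot_of_exists_lt ⟨0, h0s⟩
    have : (𝓝[>] s).NeBot := nhdsGT_neBot_of_exists_gt ⟨t, hst'⟩
    have hright : ∀ r, s < r → r ≤ t → (f r < g r ↔ f t < g t) ∧ (g r < f r ↔ g t < f t) := by
      intro r hsr hrt
      have hno' : ∀ u, r ≤ u → u ≤ t → f u ≠ g u := fun u hru => hno u (hsr.trans_le hru)
      have hr := hno' r le_rfl hrt
      have h₁ := lt_of_no_meet hrt hno'
      have h₂ := lt_of_no_meet hrt fun u h h' => (hno' u h h').symm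
      exact ⟨⟨h₁, fun h => hr.lt_or_gt.resolve_right fun h' => lt_asymm h (h₂ h')⟩,
        ⟨h₂, fun h => hr.lt_or_gt.resolve_left fun h' => lt_asymm h (h₁ h')⟩⟩
    have hleft : ∀ r < s, (∀ u, r ≤ u → u < s → f u ≠ g u) →
        meetCount f g s = meetCount f g r + 1 := by
      intro r hrs hr
      unfold meetCount
      rw [← Set.ncard_insert_of_notMem (a := s) (fun h => h.1.not_gt hrs)
        (hfin.subset fun _ hu => hu.2)]
      congr 1
      ext u
      simp only [Set.mem_ofPred_eq, Set.mem_insert_iff]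
      constructor
      · rintro ⟨hus, hu⟩
        rcases hus.eq_or_lt with rfl | hus
        · exact Or.inl rfl
        · exact Or.inr ⟨not_lt.1 fun h => hr u h.le hus hu, hu⟩
      · rintro (rfl | ⟨hur, hu⟩)
        · exact ⟨le_rfl, hs⟩
        · exact ⟨hur.trans hrs.le, hu⟩
    have hIoc : ∀ᶠ r in 𝓝[>] s, s < r ∧ r ≤ t := by
      filter_upwards [Ioo_mem_nhdsGT hst'] with r hr using ⟨hr.1, hr.2.le⟩
    have hIio : ∀ᶠ r in 𝓝[<] s, r < s := self_mem_nhdsWithin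
    rcases (hcross s hs).2 with ⟨hl, hr⟩ | ⟨hl, hr⟩
    · obtain ⟨a, ha, has, hano⟩ := (hl.and (hIio.and (eventually_no_meet_left hfin s))).exists
      obtain ⟨b, hb, hsb, hbt⟩ := (hr.and hIoc).exists
      have hcs := hleft a has hano
      have hE := (ih _ (by omega) a ha.ne rfl).1 ha
      have ht' := (hright b hsb hbt).2.1 hb
      rw [hcount, hcs]
      simp [ht'.not_gt, Nat.even_add_one, hE]
    · obtain ⟨a, ha, has, hano⟩ := (hl.and (hIio.and (eventually_no_meet_left hfin s))).exists
      obtain ⟨b, hb, hsb, hbt⟩ := (hr.and hIoc).exists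
      have hcs := hleft a has hano
      have hE := mt (ih _ (by omega) a ha.ne' rfl).2 ha.not_gt
      have ht' := (hright b hsb hbt).1.1 hb
      rw [hcount, hcs]
      simp [ht', Nat.even_add_one, hE]

namespace PathSystem

variable (S : PathSystem)

/-- Counts include a meeting at `t` itself, so a small move to the right changes none of them and
avoids all meetings. At `t = 1` the right endpoints are already distinct. -/
theorem exists_no_meet_time (t : I) : ∃ t', ∀ f ∈ S.paths, ∀ g ∈ S.paths, f ≠ g →
    f t' ≠ g t' ∧ meetCount f g t' = meetCount f g t := by
  rcases eq_or_ne t 1 with rfl | ht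
  · exact ⟨1, fun f hf g hg hfg => ⟨S.right_ne f hf g hg hfg, rfl⟩⟩
  have : (𝓝[>] t).NeBot := nhdsGT_neBot_of_exists_gt ⟨1, unitInterval.le_one'.lt_of_ne ht⟩
  have h : ∀ᶠ r in 𝓝[>] t, ∀ f ∈ S.paths, ∀ g ∈ S.paths, f ≠ g →
      ∀ u, t < u → u ≤ r → f u ≠ g u := by
    rw [Filter.eventually_all_finset]
    intro f hf
    rw [Filter.eventually_all_finset]
    intro g hg
    by_cases hfg : f = g
    · exact Filter.Eventually.of_forall fun _ h => absurd hfg h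
    · filter_upwards [eventually_no_meet_right (S.finite_inter f hf g hg hfg) t] with r hr _ using hr
  obtain ⟨r, hr, htr⟩ := (h.and self_mem_nhdsWithin).exists
  exact ⟨r, fun f hf g hg hfg => ⟨hr f hf g hg hfg r htr le_rfl,
    meetCount_eq_of_no_meet (le_of_lt htr) (hr f hf g hg hfg)⟩⟩

open Classical in
/-- The subsystem of three paths. -/
noncomputable def triple {f g h : C(I, ℝ)} (hf : f ∈ S.paths) (hg : g ∈ S.paths)
    (hh : h ∈ S.paths) (hfg : f ≠ g) (hfh : f ≠ h) (hgh : g ≠ h) : PathSystem :=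
  have hsub : ∀ p ∈ ({f, g, h} : Finset C(I, ℝ)), p ∈ S.paths := by
    intro p hp
    simp only [Finset.mem_insert, Finset.mem_singleton] at hp
    rcases hp with rfl | rfl | rfl <;> assumption
  { paths := {f, g, h}
    three_le_card := (Finset.card_eq_three.2 ⟨f, g, h, hfg, hfh, hgh, rfl⟩).ge
    left_ne := fun p hp q hq => S.left_ne p (hsub p hp) q (hsub q hq)
    right_ne := fun p hp q hq => S.right_ne p (hsub p hp) q (hsub q hq)
    finite_inter := fun p hp q hq => S.finite_inter p (hsub p hp) q (hsub q hq)
    cross := fun p hp q hq => S.cross p (hsub p hp) q (hsub q hq)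
    no_triple := fun p hp q hq r hr =>
      S.no_triple p (hsub p hp) q (hsub q hq) r (hsub r hr) }

end PathSystem

/-! ### From signatures to prefix counts of words. -/

theorem List.filter_le_eq_take {α : Type*} [LinearOrder α] {l : List α}
    (hl : l.Pairwise (· ≤ ·)) (t : α) :
    l.filter (· ≤ t) = l.take (l.filter (· ≤ t)).length := by
  induction l with
  | nil => simp
  | cons a l ih =>
    rw [List.pairwise_cons] at hl
    by_cases h : a ≤ t
    · rw [List.filter_cons_of_pos (by simpa), List.length_cons, List.take_succ_cons, ← ih hl.2]
    · have : (a :: l).filter (· ≤ t) = [] := by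
        simp only [List.filter_eq_nil_iff, List.mem_cons, decide_eq_true_eq]
        rintro b (rfl | hb)
        exacts [h, fun hbt => h ((hl.1 b hb).trans hbt)]
      simp [this]

theorem List.filter_le_getElem {α : Type*} [LinearOrder α] {l : List α}
    (hl : l.Pairwise (· < ·)) (r : ℕ) (hr : r < l.length) :
    l.filter (· ≤ l[r]) = l.take (r + 1) := by
  induction l generalizing r with
  | nil => simp at hr
  | cons a l ih =>
    rw [List.pairwise_cons] at hl
    cases r with
    | zero =>
      have : l.filter (· ≤ a) = [] := by
        simp only [List.filter_eq_nil_iff, decide_eq_true_eq, not_le]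
        exact hl.1
      simp [this]
    | succ r =>
      have hr' : r < l.length := by simpa using hr
      rw [List.getElem_cons_succ, List.filter_cons_of_pos
        (by simpa using (hl.1 _ (List.getElem_mem hr')).le), List.take_succ_cons, ih hl.2]

open Classical in
/-- The number of occurrences of a letter among the first `r` letters of a word. -/
noncomputable def letterCount (w : List SigLetter) (c : SigLetter) (r : ℕ) : ℕ :=
  (w.take r).countP (· = c)

theorem letterCount_zero (w : List SigLetter) (c : SigLetter) : letterCount w c 0 = 0 := by
  simp [letterCount]

theorem letterCount_step (w : List SigLetter) {r : ℕ} (hr : r < w.length) :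
    ∃ c, letterCount w c (r + 1) = letterCount w c r + 1 ∧
      ∀ d, d ≠ c → letterCount w d (r + 1) = letterCount w d r := by
  refine ⟨w[r], ?_, fun d hd => ?_⟩
  · rw [letterCount, List.take_succ_eq_append_getElem hr, List.countP_append]
    simp [letterCount]
  · rw [letterCount, List.take_succ_eq_append_getElem hr, List.countP_append]
    simp [letterCount, hd.symm]

namespace PathSystem

theorem mem_crossingTimes (T : PathSystem) (t : I) : t ∈ T.crossingTimes ↔ t ∈ T.crossingSet := by
  simp [crossingTimes]

theorem pairwise_crossingTimes (T : PathSystem) : T.crossingTimes.Pairwise (· < ·) := by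
  have h₁ : T.crossingTimes.Pairwise (· ≤ ·) := Finset.pairwise_sort _ _
  have h₂ : T.crossingTimes.Nodup := Finset.sort_nodup _ _
  exact (h₁.and h₂).imp fun h => h.1.lt_of_ne h.2

/-- The letter `c` marks the crossings of `f` and `g`. -/
def Marks (T : PathSystem) (c : SigLetter) (f g : C(I, ℝ)) : Prop :=
  ∀ t, f t = g t ↔ t ∈ T.crossingSet ∧ T.crossingLetter t = c

theorem Marks.meetCount_eq {T : PathSystem} {c : SigLetter} {f g : C(I, ℝ)}
    (h : T.Marks c f g) (t : I) : meetCount f g t =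
      letterCount T.signature c (T.crossingTimes.filter (· ≤ t)).length := by
  classical
  rw [letterCount, signature, ← List.map_take, ← List.filter_le_eq_take
    (T.pairwise_crossingTimes.imp le_of_lt), List.countP_map, List.countP_eq_length_filter,
    List.filter_filter, meetCount, ← List.toFinset_card_of_nodup
      (List.Nodup.filter _ (T.pairwise_crossingTimes.imp ne_of_lt)), ← Set.ncard_coe_finset]
  congr 1
  ext s
  simp [h s, mem_crossingTimes]
  tauto

theorem exists_time_of_index (T : PathSystem) {r : ℕ} (hr : r ≤ T.signature.length) :
    ∃ t, (T.crossingTimes.filter (· ≤ t)).length = r := by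
  have hr' : r ≤ T.crossingTimes.length := by simpa [signature] using hr
  cases r with
  | zero =>
    refine ⟨0, ?_⟩
    rw [List.length_eq_zero_iff, List.filter_eq_nil_iff]
    intro a ha ha0
    obtain ⟨f, hf, g, hg, hfg, hc⟩ := (T.mem_crossingTimes a).1 ha
    have ha0 : a ≤ 0 := by simpa using ha0
    obtain rfl : a = 0 := le_antisymm ha0 unitInterval.nonneg'
    exact T.left_ne f hf g hg hfg hc.1
  | succ r =>
    -- The list is indexed from 0, so `r + 1` crossings have occurred by this time.
    refine ⟨T.crossingTimes[r], ?_⟩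
    rw [List.filter_le_getElem T.pairwise_crossingTimes, List.length_take]
    omega

theorem length_filter_le (T : PathSystem) (t : I) :
    (T.crossingTimes.filter (· ≤ t)).length ≤ T.signature.length := by
  simpa [signature] using List.length_filter_le _ _

theorem length_filter_one (T : PathSystem) :
    (T.crossingTimes.filter (· ≤ 1)).length = T.signature.length := by
  rw [List.filter_eq_self.2 fun a _ => by simpa using unitInterval.le_one', signature,
    List.length_map]

variable (S : PathSystem) {f g h : C(I, ℝ)} (hf : f ∈ S.paths) (hg : g ∈ S.paths)
  (hh : h ∈ S.paths)

theorem triple_label (hfg : f 0 < g 0) (hgh : g 0 < h 0) :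
    let T := S.triple hf hg hh (fun e => hfg.ne (e ▸ rfl))
      (fun e => (hfg.trans hgh).ne (e ▸ rfl)) (fun e => hgh.ne (e ▸ rfl))
    T.label f = 1 ∧ T.label g = 2 ∧ T.label h = 3 := by
  have h₁ : f ≠ g := fun e => hfg.ne (e ▸ rfl)
  have h₂ : f ≠ h := fun e => (hfg.trans hgh).ne (e ▸ rfl)
  have h₃ : g ≠ h := fun e => hgh.ne (e ▸ rfl)
  have h4 := hfg.trans hgh
  refine ⟨?_, ?_, ?_⟩ <;>
    simp [label, triple, Finset.filter_insert, Finset.filter_singleton, hfg.le, hgh.le,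
      hfg.not_ge, hgh.not_ge, h4.le, h4.not_ge, h₁, h₂, h₃]

/-- Three paths never share a point, so the labels present at a crossing identify the pair. -/
theorem triple_marks (hfg : f 0 < g 0) (hgh : g 0 < h 0) :
    let T := S.triple hf hg hh (fun e => hfg.ne (e ▸ rfl))
      (fun e => (hfg.trans hgh).ne (e ▸ rfl)) (fun e => hgh.ne (e ▸ rfl))
    T.Marks .x f g ∧ T.Marks .y f h ∧ T.Marks .z g h := by
  classical
  intro T
  have h₁ : f ≠ g := fun e => hfg.ne (e ▸ rfl)
  have h₂ : f ≠ h := fun e => (hfg.trans hgh).ne (e ▸ rfl)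
  have h₃ : g ≠ h := fun e => hgh.ne (e ▸ rfl)
  obtain ⟨l₁, l₂, l₃⟩ := S.triple_label hf hg hh hfg hgh
  have hpaths : T.paths = {f, g, h} := by simp only [T, triple]
  have hfT : f ∈ T.paths := by simp [hpaths]
  have hgT : g ∈ T.paths := by simp [hpaths]
  have hhT : h ∈ T.paths := by simp [hpaths]
  have hiff : ∀ p ∈ T.paths, ∀ q ∈ T.paths, p ≠ q → ∀ t, CrossAt p q t ↔ p t = q t :=
    fun p hp q hq hpq t => ⟨fun h => h.1, T.cross p hp q hq hpq t⟩
  have hset : ∀ t, t ∈ T.crossingSet ↔ f t = g t ∨ f t = h t ∨ g t = h t := by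
    intro t
    constructor
    · rintro ⟨p, hp, q, hq, hpq, hc⟩
      have hc := hc.1
      simp only [hpaths, Finset.mem_insert, Finset.mem_singleton] at hp hq
      rcases hp with rfl | rfl | rfl <;> rcases hq with rfl | rfl | rfl <;> simp_all
    · rintro (e | e | e)
      · exact ⟨f, hfT, g, hgT, h₁, T.cross f hfT g hgT h₁ t e⟩
      · exact ⟨f, hfT, h, hhT, h₂, T.cross f hfT h hhT h₂ t e⟩
      · exact ⟨g, hgT, h, hhT, h₃, T.cross g hgT h hhT h₃ t e⟩
  have hlab : ∀ t, T.crossingLabels t = (({f, g, h} : Finset C(I, ℝ)).filter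
      fun p => ∃ q ∈ T.paths, p ≠ q ∧ p t = q t).image T.label := by
    intro t
    unfold crossingLabels
    rw [← hpaths]
    congr 1
    ext p
    simp only [Finset.mem_filter]
    exact and_congr_right fun hp => exists_congr fun q => and_congr_right fun hq =>
      and_congr_right fun hpq => hiff p hp q hq hpq t
  have hno := fun t => T.no_triple f hfT g hgT h hhT h₁ h₂ h₃ t
  have hx : ∀ t, f t = g t → T.crossingLetter t = .x := by
    intro t e
    have e₁ : f t ≠ h t := fun e' => hno t ⟨e, e.symm.trans e'⟩
    have e₂ : g t ≠ h t := fun e' => hno t ⟨e, e'⟩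
    have : T.crossingLabels t = {1, 2} := by
      rw [hlab]
      simp [hpaths, Finset.filter_insert, Finset.filter_singleton, e, e₂, e₂.symm, h₁, h₁.symm,
        T, l₁, l₂]
    simp [crossingLetter, this]
  have hy : ∀ t, f t = h t → T.crossingLetter t = .y := by
    intro t e
    have e₁ : f t ≠ g t := fun e' => hno t ⟨e', e'.symm.trans e⟩
    have e₂ : g t ≠ h t := fun e' => hno t ⟨e.trans e'.symm, e'⟩
    have : T.crossingLabels t = {1, 3} := by
      rw [hlab]
      simp [hpaths, Finset.filter_insert, Finset.filter_singleton, e, e₂, e₂.symm, h₂, h₂.symm,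
        T, l₁, l₃]
    rw [crossingLetter, this]
    rw [if_neg (by decide), if_pos rfl]
  have hz : ∀ t, g t = h t → T.crossingLetter t = .z := by
    intro t e
    have e₁ : f t ≠ g t := fun e' => hno t ⟨e', e⟩
    have e₂ : f t ≠ h t := fun e' => hno t ⟨e'.trans e.symm, e⟩
    have : T.crossingLabels t = {2, 3} := by
      rw [hlab]
      simp [hpaths, Finset.filter_insert, Finset.filter_singleton, e, e₂, e₂.symm, h₃, h₃.symm,
        T, l₂, l₃]
    rw [crossingLetter, this]
    rw [if_neg (by decide), if_neg (by decide)]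
  refine ⟨fun t => ⟨fun e => ⟨(hset t).2 (.inl e), hx t e⟩, ?_⟩,
    fun t => ⟨fun e => ⟨(hset t).2 (.inr (.inl e)), hy t e⟩, ?_⟩,
    fun t => ⟨fun e => ⟨(hset t).2 (.inr (.inr e)), hz t e⟩, ?_⟩⟩
  · rintro ⟨hc, hl⟩
    rcases (hset t).1 hc with e | e | e
    · exact e
    · exact absurd (hl.symm.trans (hy t e)) (by simp)
    · exact absurd (hl.symm.trans (hz t e)) (by simp)
  · rintro ⟨hc, hl⟩
    rcases (hset t).1 hc with e | e | e
    · exact absurd (hl.symm.trans (hx t e)) (by simp)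
    · exact e
    · exact absurd (hl.symm.trans (hz t e)) (by simp)
  · rintro ⟨hc, hl⟩
    rcases (hset t).1 hc with e | e | e
    · exact absurd (hl.symm.trans (hx t e)) (by simp)
    · exact absurd (hl.symm.trans (hy t e)) (by simp)
    · exact e

theorem exists_enumeration : ∃ e : Fin S.size → C(I, ℝ), StrictMono (fun i => e i 0) ∧
    ∀ f, f ∈ S.paths ↔ ∃ i, e i = f := by
  classical
  have hinj : Set.InjOn (fun f : C(I, ℝ) => f 0) S.paths := fun f hf g hg h => by
    by_contra hfg
    exact S.left_ne f hf g hg hfg h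
  have hcard : (S.paths.image fun f => f 0).card = S.size := Finset.card_image_of_injOn hinj
  let φ := (S.paths.image fun f => f 0).orderEmbOfFin hcard
  have hφ : ∀ i, ∃ f ∈ S.paths, f 0 = φ i := fun i => by
    exact Finset.mem_image.1 (Finset.orderEmbOfFin_mem _ hcard i)
  choose e he he0 using hφ
  refine ⟨e, fun i j hij => by simpa [he0] using hij, fun f => ⟨fun hf => ?_, ?_⟩⟩
  · have : f 0 ∈ Set.range φ := by
      rw [Finset.range_orderEmbOfFin]
      exact Finset.mem_coe.2 (Finset.mem_image_of_mem _ hf)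
    obtain ⟨i, hi⟩ := this
    exact ⟨i, hinj (he i) hf ((he0 i).trans hi)⟩
  · rintro ⟨i, rfl⟩
    exact he i

end PathSystem

/-! ### Regular systems as instances of `CrossingCounts`. -/

namespace PathSystem

variable {S : PathSystem}

/-- In a regular system the crossings of all triples follow one word. -/
theorem IsRegular.exists_word (hS : S.IsRegular) : ∃ w : List SigLetter,
    ∀ f ∈ S.paths, ∀ g ∈ S.paths, ∀ h ∈ S.paths, f 0 < g 0 → g 0 < h 0 → ∃ index : I → ℕ,
      (∀ t, index t ≤ w.length) ∧ (∀ r ≤ w.length, ∃ t, index t = r) ∧ index 1 = w.length ∧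
      ∀ t, meetCount f g t = letterCount w .x (index t) ∧
        meetCount f h t = letterCount w .y (index t) ∧
        meetCount g h t = letterCount w .z (index t) := by
  classical
  -- The word is the signature of any one triple; without triples the claim is vacuous and any word
  -- serves.
  by_cases hT : ∃ T₀ : PathSystem, T₀.IsSubsystem S ∧ T₀.size = 3
  · obtain ⟨T₀, hT₀, hsize₀⟩ := hT
    refine ⟨T₀.signature, fun f hf g hg h hh hfg hgh => ?_⟩
    have h₁ : f ≠ g := fun e => hfg.ne (e ▸ rfl)
    have h₂ : f ≠ h := fun e => (hfg.trans hgh).ne (e ▸ rfl)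
    have h₃ : g ≠ h := fun e => hgh.ne (e ▸ rfl)
    obtain ⟨mx, my, mz⟩ := S.triple_marks hf hg hh hfg hgh
    have hsub : (S.triple hf hg hh h₁ h₂ h₃).IsSubsystem S := by
      intro p hp
      simp only [triple, Finset.mem_insert, Finset.mem_singleton] at hp
      rcases hp with rfl | rfl | rfl <;> assumption
    have hsize : (S.triple hf hg hh h₁ h₂ h₃).size = 3 :=
      Finset.card_eq_three.2 ⟨f, g, h, h₁, h₂, h₃, by simp only [triple]⟩
    rw [(hS.2 T₀ _ hT₀ hsub hsize₀ hsize).1]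
    exact ⟨fun t => ((S.triple hf hg hh h₁ h₂ h₃).crossingTimes.filter (· ≤ t)).length,
      fun t => length_filter_le _ t, fun r hr => exists_time_of_index _ hr, length_filter_one _,
      fun t => ⟨mx.meetCount_eq t, my.meetCount_eq t, mz.meetCount_eq t⟩⟩
  · refine ⟨[], fun f hf g hg h hh hfg hgh => absurd ?_ hT⟩
    have h₁ : f ≠ g := fun e => hfg.ne (e ▸ rfl)
    have h₂ : f ≠ h := fun e => (hfg.trans hgh).ne (e ▸ rfl)
    have h₃ : g ≠ h := fun e => hgh.ne (e ▸ rfl)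
    refine ⟨S.triple hf hg hh h₁ h₂ h₃, fun p hp => ?_,
      Finset.card_eq_three.2 ⟨f, g, h, h₁, h₂, h₃, by simp only [triple]⟩⟩
    simp only [triple, Finset.mem_insert, Finset.mem_singleton] at hp
    rcases hp with rfl | rfl | rfl <;> assumption

theorem lt_iff_even {f g : C(I, ℝ)} (hf : f ∈ S.paths) (hg : g ∈ S.paths) (h0 : f 0 < g 0)
    {t : I} (ht : f t ≠ g t) : f t < g t ↔ Even (meetCount f g t) :=
  have hne : f ≠ g := fun e => h0.ne (e ▸ rfl)
  lt_iff_even_meetCount (S.finite_inter f hf g hg hne) (S.cross f hf g hg hne) h0 t ht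

theorem gt_iff_odd {f g : C(I, ℝ)} (hf : f ∈ S.paths) (hg : g ∈ S.paths) (h0 : f 0 < g 0)
    {t : I} (ht : f t ≠ g t) : g t < f t ↔ Odd (meetCount f g t) := by
  rw [← Nat.not_even_iff_odd, ← lt_iff_even hf hg h0 ht, not_lt]
  exact ⟨le_of_lt, fun h => h.lt_of_ne ht.symm⟩

theorem IsCrossing.meetCount_one {k : ℕ} (hk : S.IsCrossing k) {f g : C(I, ℝ)}
    (hf : f ∈ S.paths) (hg : g ∈ S.paths) (hfg : f ≠ g) :
    1 ≤ meetCount f g 1 ∧ meetCount f g 1 ≤ k := by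
  have : meetCount f g 1 = {t : I | CrossAt f g t}.ncard := by
    unfold meetCount
    congr 1
    ext t
    exact ⟨fun h => S.cross f hf g hg hfg t h.2, fun h => ⟨unitInterval.le_one', h.1⟩⟩
  rw [this]
  exact hk f hf g hg hfg

/-- The crossing counts of a regular system whose paths are enumerated from bottom to top. -/
theorem IsRegular.exists_crossingCounts (hS : S.IsRegular) {e : Fin S.size → C(I, ℝ)}
    (he : StrictMono fun i => e i 0) (hmem : ∀ f, f ∈ S.paths ↔ ∃ i, e i = f) :
    ∃ (L m : ℕ) (c : CrossingCounts S.size L m I),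
      (∀ i j, i ≠ j → c.N i j = meetCount (e i) (e j)) ∧
      ∃ i j, i ≠ j ∧ m = meetCount (e i) (e j) 1 := by
  have hn : 4 ≤ S.size := hS.1
  have hin : ∀ i, e i ∈ S.paths := fun i => (hmem _).2 ⟨i, rfl⟩
  have hinj : Function.Injective e := fun i j hij => he.injective (congrArg (fun f => f 0) hij)
  obtain ⟨w, hw⟩ := hS.exists_word
  have hidx := fun i j k (hij : i < j) (hjk : j < k) =>
    hw _ (hin i) _ (hin j) _ (hin k) (he hij) (he hjk)
  have hone : ∀ i j k, i < j → j < k → meetCount (e i) (e j) 1 = letterCount w .x w.length ∧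
      meetCount (e i) (e k) 1 = letterCount w .y w.length ∧
      meetCount (e j) (e k) 1 = letterCount w .z w.length := by
    intro i j k hij hjk
    obtain ⟨ind, -, -, h1, h⟩ := hidx i j k hij hjk
    rw [← h1]
    exact h 1
  let i₀ : Fin S.size := ⟨0, by omega⟩
  let i₁ : Fin S.size := ⟨1, by omega⟩
  let i₂ : Fin S.size := ⟨2, by omega⟩
  let i₃ : Fin S.size := ⟨3, by omega⟩
  have h01 : i₀ < i₁ := Fin.mk_lt_mk.2 (by omega)
  have h12 : i₁ < i₂ := Fin.mk_lt_mk.2 (by omega)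
  have h23 : i₂ < i₃ := Fin.mk_lt_mk.2 (by omega)
  obtain ⟨ind, hind, hind', -, hcount⟩ := hidx i₀ i₁ i₂ h01 h12
  have hsign : ∀ r ≤ w.length, ∃ t, e i₀ t ≠ e i₁ t ∧ e i₀ t ≠ e i₂ t ∧ e i₁ t ≠ e i₂ t ∧
      meetCount (e i₀) (e i₁) t = letterCount w .x r ∧
      meetCount (e i₀) (e i₂) t = letterCount w .y r ∧
      meetCount (e i₁) (e i₂) t = letterCount w .z r := by
    intro r hr
    obtain ⟨t, rfl⟩ := hind' r hr
    obtain ⟨t', ht'⟩ := S.exists_no_meet_time t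
    obtain ⟨a₁, a₂⟩ := ht' _ (hin i₀) _ (hin i₁) (hinj.ne h01.ne)
    obtain ⟨b₁, b₂⟩ := ht' _ (hin i₀) _ (hin i₂) (hinj.ne (h01.trans h12).ne)
    obtain ⟨c₁, c₂⟩ := ht' _ (hin i₁) _ (hin i₂) (hinj.ne h12.ne)
    obtain ⟨d₁, d₂, d₃⟩ := hcount t
    exact ⟨t', a₁, b₁, c₁, a₂.trans d₁, b₂.trans d₂, c₂.trans d₃⟩
  -- The two excluded parity patterns would make the order of three values cyclic.
  have hpar : ∀ r ≤ w.length,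
      (Even (letterCount w .x r) → Odd (letterCount w .y r) → ¬ Even (letterCount w .z r)) ∧
      (Odd (letterCount w .x r) → Even (letterCount w .y r) → ¬ Odd (letterCount w .z r)) := by
    intro r hr
    obtain ⟨t, n₁, n₂, n₃, c₁, c₂, c₃⟩ := hsign r hr
    have e₁ := lt_iff_even (hin _) (hin _) (he h01) n₁
    have e₂ := lt_iff_even (hin _) (hin _) (he (h01.trans h12)) n₂
    have e₃ := lt_iff_even (hin _) (hin _) (he h12) n₃
    have o₁ := gt_iff_odd (hin _) (hin _) (he h01) n₁
    have o₂ := gt_iff_odd (hin _) (hin _) (he (h01.trans h12)) n₂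
    have o₃ := gt_iff_odd (hin _) (hin _) (he h12) n₃
    rw [c₁] at e₁ o₁
    rw [c₂] at e₂ o₂
    rw [c₃] at e₃ o₃
    rw [← e₁, ← e₂, ← e₃, ← o₁, ← o₂, ← o₃]
    exact ⟨fun a b c => lt_asymm (a.trans c) b, fun a b c => lt_asymm (c.trans a) b⟩
  refine ⟨w.length, letterCount w .x w.length,
    -- A path meets itself everywhere, so the diagonal gets the harmless value 0.
    { N := fun i j => if i = j then 0 else meetCount (e i) (e j)
      symm := fun i j => by
        by_cases hij : i = j
        · simp [hij]
        · simp only [hij, Ne.symm hij, if_false, meetCount_comm (e i)]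
      counting := fun i j => by
        by_cases hij : i = j
        · refine ⟨fun a b _ => by simp [hij], fun t a ha => ⟨⊥, ?_, fun _ _ => bot_le⟩⟩
          simpa [hij] using ha
        · simp only [hij, if_false]
          exact isCounting_meetCount (S.finite_inter _ (hin i) _ (hin j) (hinj.ne hij))
      X := letterCount w .x
      Y := letterCount w .y
      Z := letterCount w .z
      exists_index := fun i j k hij hjk t => by
        obtain ⟨ind, h₁, -, -, h⟩ := hidx i j k hij hjk
        simp only [hij.ne, hjk.ne, (hij.trans hjk).ne, if_false]
        exact ⟨ind t, h₁ t, h t⟩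
      exists_time := fun i j k hij hjk r hr => by
        obtain ⟨ind, -, h₁, -, h⟩ := hidx i j k hij hjk
        simp only [hij.ne, hjk.ne, (hij.trans hjk).ne, if_false]
        obtain ⟨t, rfl⟩ := h₁ r hr
        exact ⟨t, h t⟩
      zero := ⟨letterCount_zero _ _, letterCount_zero _ _, letterCount_zero _ _⟩
      -- A fourth path makes the totals agree: `{i₀, i₂}` is a `y` pair below `i₃` with `i₁` and an
      -- `x` pair with `i₃`, while `{i₁, i₂}` is a `z` pair with `i₀` and an `x` pair with `i₃`.
      last := by
        have a := hone i₀ i₁ i₂ h01 h12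
        have b := hone i₀ i₂ i₃ (h01.trans h12) h23
        have d := hone i₁ i₂ i₃ h12 h23
        exact ⟨rfl, a.2.1.symm.trans b.1, a.2.2.symm.trans d.1⟩
      step := fun r hr => by
        obtain ⟨c, hc, hd⟩ := letterCount_step w hr
        cases c
        · exact .inl ⟨hc, hd _ (by simp), hd _ (by simp)⟩
        · exact .inr (.inl ⟨hd _ (by simp), hc, hd _ (by simp)⟩)
        · exact .inr (.inr ⟨hd _ (by simp), hd _ (by simp), hc⟩)
      not_even_odd_even := fun r hr => (hpar r hr).1
      not_odd_even_odd := fun r hr => (hpar r hr).2 },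
    fun i j hij => by simp [hij], i₀, i₁, h01.ne, (hone i₀ i₁ i₂ h01 h12).1.symm⟩

theorem mem_upperEnvelope_iff {e : Fin S.size → C(I, ℝ)}
    (he : StrictMono fun i => e i 0) (hmem : ∀ f, f ∈ S.paths ↔ ∃ i, e i = f) {L m : ℕ}
    (c : CrossingCounts S.size L m I) (hc : ∀ i j, i ≠ j → c.N i j = meetCount (e i) (e j))
    (i : Fin S.size) : e i ∈ S.upperEnvelope ↔ c.Appears i := by
  have hin : ∀ i, e i ∈ S.paths := fun i => (hmem _).2 ⟨i, rfl⟩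
  have hinj : Function.Injective e := fun i j hij => he.injective (congrArg (fun f => f 0) hij)
  simp only [upperEnvelope, Finset.mem_filter, hin i, true_and]
  constructor
  · rintro ⟨t, ht⟩
    refine ⟨t, fun j hij => ?_, fun j hji => ?_⟩
    · have hlt := ht _ (hin j) (hinj.ne hij.ne')
      rw [hc i j hij.ne]
      exact (gt_iff_odd (hin i) (hin j) (he hij) hlt.ne').1 hlt
    · have hlt := ht _ (hin j) (hinj.ne hji.ne)
      rw [hc i j hji.ne', meetCount_comm]
      exact (lt_iff_even (hin j) (hin i) (he hji) hlt.ne).1 hlt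
  · rintro ⟨t, h₁, h₂⟩
    obtain ⟨t', ht'⟩ := S.exists_no_meet_time t
    refine ⟨t', fun g hg hge => ?_⟩
    obtain ⟨j, rfl⟩ := (hmem g).1 hg
    have hji : j ≠ i := fun h => hge (h ▸ rfl)
    rcases hji.lt_or_gt with hlt | hlt
    · obtain ⟨a, b⟩ := ht' _ (hin j) _ (hin i) (hinj.ne hji)
      refine (lt_iff_even (hin j) (hin i) (he hlt) a).2 ?_
      rw [b, ← hc j i hji, c.symm]
      exact h₂ j hlt
    · obtain ⟨a, b⟩ := ht' _ (hin i) _ (hin j) (hinj.ne hji.symm)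
      refine (gt_iff_odd (hin i) (hin j) (he hlt) a).2 ?_
      rw [b, ← hc i j hji.symm]
      exact h₁ j hlt

/-- If every two paths cross, at least two paths appear on the upper envelope. -/
theorem IsCrossing.two_le_card_upperEnvelope {k : ℕ} (hk : S.IsCrossing k) :
    2 ≤ S.upperEnvelope.card := by
  classical
  have htop : ∀ t, (∀ f ∈ S.paths, ∀ g ∈ S.paths, f ≠ g → f t ≠ g t) →
      ∃ f ∈ S.upperEnvelope, ∀ g ∈ S.paths, g ≠ f → g t < f t := by
    intro t ht
    obtain ⟨f, hf, hmax⟩ := S.paths.exists_max_image (fun f => f t)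
      (Finset.card_pos.1 (by have := S.three_le_card; omega))
    have hlt : ∀ g ∈ S.paths, g ≠ f → g t < f t := fun g hg hgf =>
      (hmax g hg).lt_of_ne (ht g hg f hf hgf)
    exact ⟨f, Finset.mem_filter.2 ⟨hf, t, hlt⟩, hlt⟩
  obtain ⟨f, hfE, hf⟩ := htop 0 S.left_ne
  have hfS : f ∈ S.paths := (Finset.mem_filter.1 hfE).1
  obtain ⟨g, hgS, hgf⟩ : ∃ g ∈ S.paths, g ≠ f :=
    Finset.exists_mem_ne (by have := S.three_le_card; omega) f
  have hg0 := hf g hgS hgf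
  have hcount := (hk.meetCount_one hgS hfS hgf).1
  -- On one side of a crossing `g` is above the initial top path `f`, so a path other than `f` is on
  -- top there.
  obtain ⟨r, hr⟩ : ∃ r, f r < g r := by
    obtain ⟨s, -, hs⟩ := Set.nonempty_of_ncard_ne_zero
      (show {s : I | s ≤ 1 ∧ g s = f s}.ncard ≠ 0 from (Nat.one_le_iff_ne_zero.1 hcount))
    have h0s : 0 < s := unitInterval.nonneg'.lt_of_ne fun h => hg0.ne (h ▸ hs)
    have hs1 : s < 1 := unitInterval.le_one'.lt_of_ne fun h =>
      S.right_ne g hgS f hfS hgf (h ▸ hs)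
    have : (𝓝[<] s).NeBot := nhdsLT_neBot_of_exists_lt ⟨0, h0s⟩
    have : (𝓝[>] s).NeBot := nhdsGT_neBot_of_exists_gt ⟨1, hs1⟩
    rcases (S.cross g hgS f hfS hgf s hs).2 with ⟨-, h⟩ | ⟨h, -⟩ <;> exact h.exists
  obtain ⟨t₁, ht₁⟩ := S.exists_no_meet_time r
  have hlt : f t₁ < g t₁ := by
    rw [gt_iff_odd hgS hfS hg0 (ht₁ g hgS f hfS hgf).1, (ht₁ g hgS f hfS hgf).2,
      ← gt_iff_odd hgS hfS hg0 hr.ne']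
    exact hr
  obtain ⟨h, hhE, hh⟩ := htop t₁ fun p hp q hq hpq => (ht₁ p hp q hq hpq).1
  refine Finset.one_lt_card.2 ⟨f, hfE, h, hhE, ?_⟩
  rintro rfl
  exact lt_asymm hlt (hh g hgS hgf)

end PathSystem

/-! ### The theorem. -/

theorem mainTheorem5 (S : PathSystem) (hS : S.IsRegular) :
    (S.IsCrossing 2 → S.UpperConvex ∨ S.upperEnvelope.card = 2) ∧
    (S.IsCrossing 4 → S.UpperConvex ∨ S.upperEnvelope.card ≤ 3) ∧
    (∀ k : ℕ, 4 < k → S.IsCrossing k → S.UpperConvex ∨ S.upperEnvelope.card ≤ 4) := by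
  classical
  obtain ⟨e, he, hmem⟩ := S.exists_enumeration
  obtain ⟨L, m, c, hc, i, j, hij, hm⟩ := hS.exists_crossingCounts he hmem
  have hn : 4 ≤ S.size := hS.1
  have hin : ∀ i, e i ∈ S.paths := fun i => (hmem _).2 ⟨i, rfl⟩
  have hinj : Function.Injective e := fun i j hij => he.injective (congrArg (fun f => f 0) hij)
  have hmk : ∀ k, S.IsCrossing k → m ≤ k := fun k hk => by
    rw [hm]
    exact (hk.meetCount_one (hin i) (hin j) (hinj.ne hij)).2
  have happ := PathSystem.mem_upperEnvelope_iff he hmem c hc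
  have himage : S.upperEnvelope = (Finset.univ.filter c.Appears).image e := by
    ext f
    simp only [Finset.mem_image, Finset.mem_filter, Finset.mem_univ, true_and]
    constructor
    · intro hf
      obtain ⟨i, rfl⟩ := (hmem f).1 (Finset.mem_filter.1 hf).1
      exact ⟨i, (happ i).1 hf, rfl⟩
    · rintro ⟨i, hi, rfl⟩
      exact (happ i).2 hi
  have hcard : S.upperEnvelope.card = (Finset.univ.filter c.Appears).card := by
    rw [himage, Finset.card_image_of_injective _ hinj]
  have hconv : (∀ i, c.Appears i) → S.UpperConvex := fun h => by
    refine Finset.Subset.antisymm (Finset.filter_subset _ _) fun f hf => ?_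
    obtain ⟨i, rfl⟩ := (hmem f).1 hf
    exact (happ i).2 (h i)
  by_cases hU : c.Universal
  · have := hconv (hU.appears c (by omega))
    exact ⟨fun _ => .inl this, fun _ => .inl this, fun _ _ _ => .inl this⟩
  have hE : ∀ i ∈ Finset.univ.filter c.Appears, c.Appears i := fun i hi =>
    (Finset.mem_filter.1 hi).2
  refine ⟨fun hk => .inr (le_antisymm ?_ hk.two_le_card_upperEnvelope), fun hk => ?_,
    fun k _ _ => .inr ?_⟩
  · exact hcard.trans_le (c.card_le_two hn (hmk 2 hk) hU _ hE)
  · by_cases hall : ∀ i, c.Appears i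
    · exact .inl (hconv hall)
    · refine .inr (hcard.trans_le (c.card_le_three hn (hmk 4 hk) hU _ hE fun h => hall fun i => ?_))
      exact hE i (h.symm.subset (Finset.mem_univ i))
  · exact hcard.trans_le (c.card_le_four hn hU _ hE)
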